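/- \textbf{Conventions.} A Borel space is a Borel subset of a Polish space. For a Borel space $Z$, $\mathcal P(Z)$ is the set of Borel probability measures on $Z$ with the Borel $\sigma$-algebra of the weak topology. The universal $\sigma$-algebra of $Z$ is the intersection over all $p\in\mathcal P(Z)$ of the $p$-completions of its Borel $\sigma$-algebra. A universally measurable stochastic kernel on $Y$ given $Z$ assigns to each $z\in Z$ some $\mu(\cdot\mid z)\in\mathcal P(Y)$ such that $z\mapsto\mu(B\mid z)$ is universally measurable for each Borel $B\subset Y$. A subset of a Borel space is analytic if it is empty or the image of a Borel subset of a Polish space under a Borel measurable map. A function $\phi:\mathcal P(Z)\to[-\infty,+\infty]$ is upper semianalytic if $\{\phi\ge r\}$ is analytic for every $r\in\mathbb R$. \textbf{Model.} Let $\mathbb X,\mathbb A_1,\mathbb A_2$ be Borel spaces, $\mathbb A=\mathbb A_1\times\mathbb A_2$, and let $q(dy\mid x,a)$ be a Borel measurable stochastic kernel on $\mathbb X$ given $\mathbb X\times\mathbb A$. For $i=1,2$ and $x\in\mathbb X$ let $A_i(x)\subset\mathbb A_i$ be nonempty, with analytic graphs $\{(x,a^i): a^i\in A_i(x)\}$.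 Let $\Omega=(\mathbb X\times\mathbb A)^\infty$; write $a_n=(a_n^1,a_n^2)$, $h_n=(x_0,a_0,\dots,x_{n-1},a_{n-1},x_n)\in H_n$ and $i_n=(x_0,a_0^1,\dots,x_{n-1},a^1_{n-1},x_n)\in I_n$. A policy $\pi_1=\{\mu_n^1\}_{n\ge0}\in\Pi_1$ of player 1 consists of universally measurable stochastic kernels on $\mathbb A_1$ given $I_n$ with $\mu^1_n(A_1(x_n)\mid i_n)=1$ for all $i_n\in I_n$; a policy $\pi_2=\{\mu_n^2\}_{n\ge0}\in\Pi_2$ of player 2 consists of universally measurable stochastic kernels on $\mathbb A_2$ given $H_n$ with $\mu^2_n(A_2(x_n)\mid h_n)=1$ for all $h_n\in H_n$. Let $\rho_x[\pi_1,\pi_2]\in\mathcal P(\Omega)$ be the law of $(x_0,a_0,x_1,a_1,\dots)$ with $x_0=x$, where given $h_n$ the actions $a_n^1,a_n^2$ are drawn independently from $\mu_n^1(\cdot\mid i_n)$ and $\mu_n^2(\cdot\mid h_n)$, and then $x_{n+1}$ is drawn from $q(\cdot\mid x_n,a_n)$. Let $J^\star:\Pi_1\times\Pi_2\times\mathbb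 X\to[-\infty,+\infty]$ be a given criterion. \textbf{Shifted policies.} For $\tilde i_1\in\mathbb X\times\mathbb A_1$ and $\tilde h_1\in\mathbb X\times\mathbb A$, the shifted policies $\pi_1^s(\tilde i_1)\in\Pi_1$ and $\pi_2^s(\tilde h_1)\in\Pi_2$ have the kernels $\mu^1_{n+1}(\cdot\mid\tilde i_1,i_n)$ and $\mu^2_{n+1}(\cdot\mid\tilde h_1,h_n)$, $n\ge0$, respectively. \textbf{Assumptions.} (1) For all $\pi_1\in\Pi_1$, $\pi_2,\hat\pi_2\in\Pi_2$, $x\in\mathbb X$, $n\ge0$, the marginals on $I_n$ of $\rho_x[\pi_1,\pi_2]$ and $\rho_x[\pi_1,\hat\pi_2]$ are mutually absolutely continuous. (2) There is an upper semianalytic $\phi:\mathcal P(\Omega)\to[-\infty,+\infty]$ with $J^\star(\pi_1,\pi_2,x)=\phi(\rho_x[\pi_1,\pi_2])$ for all $x\in\mathbb X$, $\pi_1\in\Pi_1$, $\pi_2\in\Pi_2$. \textbf{Claim.} Under (1) and (2), for every $\bar\pi_1\in\Pi_1$ and $\epsilon>0$ there is $\pi_2\in\Pi_2$ such that $$J^\star\big(\bar\pi_1^s(\tilde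 i_1),\pi_2^s(\tilde h_1),x\big)\ \ge\ f_\epsilon\big(\bar\pi_1^s(\tilde i_1),x\big)\qquad\text{for all }x\in\mathbb X,\ \tilde i_1\in\mathbb X\times\mathbb A_1,\ \tilde h_1=(\tilde i_1,\tilde a_0^2)\in\mathbb X\times\mathbb A,$$ where $f_\epsilon(\pi_1',x)=\sup_{\pi_2'\in\Pi_2}J^\star(\pi_1',\pi_2',x)-\epsilon$ if this supremum is $<+\infty$, and $f_\epsilon(\pi_1',x)=1/\epsilon$ otherwise. -/

import Mathlib

open MeasureTheory ProbabilityTheory Set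
open scoped ENNReal

noncomputable section

namespace Minimax

universe u v w

/-! ### Universally measurable sets and kernels, analytic sets, semianalytic functions -/

/-- The universal `σ`-algebra `𝓤(X)`: the intersection, over all Borel probability measures `p`
on `X`, of the `p`-completions of the Borel `σ`-algebra. -/
@[reducible] def univSigma (X : Type u) [MeasurableSpace X] : MeasurableSpace X where
  MeasurableSet' s := ∀ p : ProbabilityMeasure X, NullMeasurableSet s p.toMeasure
  measurableSet_empty _ := nullMeasurableSet_empty
  measurableSet_compl _ hs p := (hs p).compl
  measurableSet_iUnion _ hs p := NullMeasurableSet.iUnion fun i => hs i p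

/-- A Borel map is measurable between the universal `σ`-algebras. -/
theorem measurable_univSigma_of_measurable {X : Type u} {Y : Type v} [MeasurableSpace X]
    [MeasurableSpace Y] {g : X → Y} (hg : Measurable g) :
    @Measurable X Y (univSigma X) (univSigma Y) g := by
  intro s hs p
  exact (hs (p.map hg.aemeasurable)).preimage (hg.quasiMeasurePreserving p.toMeasure)

/-- A universally measurable stochastic kernel on `Y` given `X`. -/
structure UnivKernel (X : Type u) (Y : Type v) [MeasurableSpace X] [MeasurableSpace Y] where
  /-- the probability measure on `Y` attached to a point of `X` -/
  toFun : X → Measure Y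
  prob : ∀ x, IsProbabilityMeasure (toFun x)
  meas : ∀ B : Set Y, MeasurableSet B →
    @Measurable X ℝ≥0∞ (univSigma X) _ (fun x => toFun x B)

/-- Substituting a Borel map into the conditioning variable of a universally measurable kernel. -/
def UnivKernel.comap {X : Type u} {Y : Type v} {W : Type w} [MeasurableSpace X]
    [MeasurableSpace Y] [MeasurableSpace W] (κ : UnivKernel X Y) (g : W → X)
    (hg : Measurable g) : UnivKernel W Y where
  toFun z := κ.toFun (g z)
  prob z := κ.prob (g z)
  meas B hB := (κ.meas B hB).comp (measurable_univSigma_of_measurable hg)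

/-- Analytic subset of a Borel space: an image of a Borel space (that is, of a Borel subset of a
Polish space) under a Borel measurable map. The empty set is the image of the empty space, and up
to Borel isomorphism every Borel space lives in `Type`. -/
def IsAnalytic {X : Type u} [MeasurableSpace X] (s : Set X) : Prop :=
  ∃ (Y : Type) (_ : MeasurableSpace Y) (_ : StandardBorelSpace Y) (f : Y → X),
    Measurable f ∧ Set.range f = s

/-- Upper semianalytic functions on a Borel space. -/
def UpperSemianalytic {X : Type u} [MeasurableSpace X] (f : X → EReal) : Prop :=
  ∀ r : ℝ, IsAnalytic {x | (r : EReal) ≤ f x}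

/-! ### The minimax control model -/

/-- The minimax control model on the state space `X`, with action spaces `A₁` (controller) and
`A₂` (opponent). -/
structure Model (X : Type u) (A₁ : Type v) (A₂ : Type w)
    [MeasurableSpace X] [MeasurableSpace A₁] [MeasurableSpace A₂] where
  /-- the Borel measurable state transition stochastic kernel -/
  q : Kernel (X × A₁ × A₂) X
  markov : IsMarkovKernel q
  /-- admissible actions of player 1 -/
  adm₁ : X → Set A₁
  /-- admissible actions of player 2 -/
  adm₂ : X → Set A₂
  adm₁_nonempty : ∀ x, (adm₁ x).Nonempty
  adm₂_nonempty : ∀ x, (adm₂ x).Nonempty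
  adm₁_analytic : IsAnalytic {z : X × A₁ | z.2 ∈ adm₁ z.1}
  adm₂_analytic : IsAnalytic {z : X × A₂ | z.2 ∈ adm₂ z.1}

/-- The histories `(x_0, b_0, …, x_{n-1}, b_{n-1}, x_n)` with `b_k` in `B`: for `B = A₁ × A₂` this
is the space `H_n`, for `B = A₁` the space `I_n`. -/
abbrev Hist (X : Type u) (B : Type v) (n : ℕ) : Type (max u v) := (Fin n → X × B) × X

/-- The sample space `Ω = (X × A₁ × A₂)^∞`. -/
abbrev Path (X : Type u) (A₁ : Type v) (A₂ : Type w) : Type (max u v w) := ℕ → X × A₁ × A₂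

section Histories

variable {X : Type u} {A₁ : Type v} {A₂ : Type w}

/-- The information vector `i_n` of player 1 contained in the full history `h_n`. -/
def Hist.info {n : ℕ} (h : Hist X (A₁ × A₂) n) : Hist X A₁ n :=
  (fun k => ((h.1 k).1, (h.1 k).2.1), h.2)

/-- The history `(b, h_n)` of length `n + 1` obtained by putting the stage `b` in front. -/
def Hist.cons {B : Type v} {n : ℕ} (b : X × B) (h : Hist X B n) : Hist X B (n + 1) :=
  (Fin.cons b h.1, h.2)

/-- The history `h_n` along a path. -/
def Path.hist (n : ℕ) (ω : Path X A₁ A₂) : Hist X (A₁ × A₂) n := (fun k => ω k, (ω n).1)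

/-- The history `h'_n = (x_0, a_0, …, x_n, a_n)` along a path. -/
def Path.hist' (n : ℕ) (ω : Path X A₁ A₂) : Fin (n + 1) → X × A₁ × A₂ := fun k => ω k

/-- The information vector `i_n` along a path. -/
def Path.info (n : ℕ) (ω : Path X A₁ A₂) : Hist X A₁ n := (Path.hist n ω).info

variable [MeasurableSpace X] [MeasurableSpace A₁] [MeasurableSpace A₂]

theorem measurable_info {n : ℕ} : Measurable (Hist.info : Hist X (A₁ × A₂) n → Hist X A₁ n) := by
  unfold Hist.info
  fun_prop

theorem measurable_cons {B : Type v} [MeasurableSpace B] {n : ℕ} (b : X × B) :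
    Measurable (Hist.cons b : Hist X B n → Hist X B (n + 1)) := by
  unfold Hist.cons
  refine Measurable.prodMk (measurable_pi_iff.2 fun i => ?_) measurable_snd
  refine Fin.cases ?_ (fun j => ?_) i
  · simp
  · simp only [Fin.cons_succ]
    fun_prop

theorem measurable_hist (n : ℕ) :
    Measurable (Path.hist n : Path X A₁ A₂ → Hist X (A₁ × A₂) n) := by
  unfold Path.hist
  fun_prop

theorem measurable_hist' (n : ℕ) :
    Measurable (Path.hist' n : Path X A₁ A₂ → Fin (n + 1) → X × A₁ × A₂) := by
  unfold Path.hist'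
  fun_prop

end Histories

section Policies

variable {X : Type u} {A₁ : Type v} {A₂ : Type w}
  [MeasurableSpace X] [MeasurableSpace A₁] [MeasurableSpace A₂]

/-- The policies `Π₁` of player 1. -/
structure Policy₁ (M : Model X A₁ A₂) where
  /-- the kernel on `A₁` given `I_n` -/
  kernel : ∀ n : ℕ, UnivKernel (Hist X A₁ n) A₁
  feasible : ∀ (n : ℕ) (i : Hist X A₁ n), (kernel n).toFun i (M.adm₁ i.2) = 1

/-- The policies `Π₂` of player 2. -/
structure Policy₂ (M : Model X A₁ A₂) where
  /-- the kernel on `A₂` given `H_n` -/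
  kernel : ∀ n : ℕ, UnivKernel (Hist X (A₁ × A₂) n) A₂
  feasible : ∀ (n : ℕ) (h : Hist X (A₁ × A₂) n), (kernel n).toFun h (M.adm₂ h.2) = 1

/-- The shifted policy of player 1 after the first stage `i = (x_0, a_0^1)`. -/
def Policy₁.shift {M : Model X A₁ A₂} (π : Policy₁ M) (i : X × A₁) : Policy₁ M where
  kernel n := (π.kernel (n + 1)).comap (Hist.cons i) (measurable_cons i)
  feasible n j := π.feasible (n + 1) (Hist.cons i j)

/-- The shifted policy of player 2 after the first stage `h = (x_0, a_0^1, a_0^2)`. -/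
def Policy₂.shift {M : Model X A₁ A₂} (π : Policy₂ M) (h : X × A₁ × A₂) : Policy₂ M where
  kernel n := (π.kernel (n + 1)).comap (Hist.cons h) (measurable_cons h)
  feasible n j := π.feasible (n + 1) (Hist.cons h j)

/-! ### The measure induced by a policy pair -/

/-- `P` is the law on `Ω` determined by the initial distribution `p₀`, the policies `π₁`, `π₂` and
the transition kernel `q`: given `h_n`, the actions `a_n^1`, `a_n^2` are drawn independently from
`μ_n^1(· | i_n)`, `μ_n^2(· | h_n)`, and given `h'_n`, the state `x_{n+1}` is drawn from
`q(· | x_n, a_n)`. -/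
structure IsInducedBy (M : Model X A₁ A₂) (p₀ : Measure X) (π₁ : Policy₁ M) (π₂ : Policy₂ M)
    (P : Measure (Path X A₁ A₂)) : Prop where
  init : ∀ D : Set X, MeasurableSet D → P {ω | (ω 0).1 ∈ D} = p₀ D
  action : ∀ (n : ℕ) (B : Set (Hist X (A₁ × A₂) n)) (C₁ : Set A₁) (C₂ : Set A₂),
    MeasurableSet B → MeasurableSet C₁ → MeasurableSet C₂ →
    P {ω | Path.hist n ω ∈ B ∧ (ω n).2.1 ∈ C₁ ∧ (ω n).2.2 ∈ C₂} =
      ∫⁻ ω in {ω | Path.hist n ω ∈ B},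
        (π₁.kernel n).toFun (Path.info n ω) C₁ * (π₂.kernel n).toFun (Path.hist n ω) C₂ ∂P
  trans : ∀ (n : ℕ) (B : Set (Fin (n + 1) → X × A₁ × A₂)) (D : Set X),
    MeasurableSet B → MeasurableSet D →
    P {ω | Path.hist' n ω ∈ B ∧ (ω (n + 1)).1 ∈ D} =
      ∫⁻ ω in {ω | Path.hist' n ω ∈ B}, M.q (ω n) D ∂P

/-- A universally measurable function is almost everywhere measurable. -/
theorem aemeasurable_of_univSigma {Y : Type*} [MeasurableSpace Y] {f : Y → ℝ≥0∞}
    (hf : @Measurable Y ℝ≥0∞ (univSigma Y) _ f) (l : Measure Y) [IsProbabilityMeasure l] :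
    AEMeasurable f l := by
  have h : NullMeasurable f l := fun s hs => hf hs ⟨l, inferInstance⟩
  exact h.aemeasurable

/-- A universally measurable kernel has a Borel version with respect to any probability measure. -/
theorem UnivKernel.exists_version {H : Type u} {A : Type v} [MeasurableSpace H] [MeasurableSpace A]
    [MeasurableSpace.CountablyGenerated A] (κ : UnivKernel H A) (l : Measure H)
    [IsProbabilityMeasure l] :
    ∃ η : Kernel H A, IsMarkovKernel η ∧ ∀ᵐ h ∂l, η h = κ.toFun h := by
  classical
  have hne : Nonempty H := nonempty_of_isProbabilityMeasure l
  obtain ⟨h₀⟩ := hne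
  set S : Set (Set A) := generateSetAlgebra (MeasurableSpace.countableGeneratingSet A) with hS
  have hSc : S.Countable :=
    countable_generateSetAlgebra (MeasurableSpace.countable_countableGeneratingSet (α := A))
  have hgen : ‹MeasurableSpace A› = MeasurableSpace.generateFrom S := by
    rw [hS, generateFrom_generateSetAlgebra_eq,
      MeasurableSpace.generateFrom_countableGeneratingSet]
  have hpi : IsPiSystem S := fun s hs t ht _ => isSetAlgebra_generateSetAlgebra.inter_mem hs ht
  have hSm : ∀ s ∈ S, MeasurableSet s := fun s hs => by
    rw [hgen]; exact MeasurableSpace.measurableSet_generateFrom hs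
  have haem : ∀ s ∈ S, AEMeasurable (fun h => κ.toFun h s) l := fun s hs =>
    aemeasurable_of_univSigma (κ.meas s (hSm s hs)) l
  have hall : ∀ᵐ h ∂l, ∀ s (hs : s ∈ S), κ.toFun h s = (haem s hs).mk _ h :=
    (ae_ball_iff hSc).2 fun s hs => (haem s hs).ae_eq_mk
  obtain ⟨G, hGsub, hGm, hG0⟩ := exists_measurable_superset_of_null (ae_iff.1 hall)
  have hprob : ∀ h, IsProbabilityMeasure (if h ∈ G then κ.toFun h₀ else κ.toFun h) := by
    intro h
    split_ifs
    · exact κ.prob h₀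
    · exact κ.prob h
  have hmeas : Measurable fun h => if h ∈ G then κ.toFun h₀ else κ.toFun h := by
    refine Measurable.measure_of_isPiSystem_of_isProbabilityMeasure hgen hpi fun s hs => ?_
    have : (fun h => (if h ∈ G then κ.toFun h₀ else κ.toFun h) s) =
        fun h => if h ∈ G then κ.toFun h₀ s else (haem s hs).mk _ h := by
      funext h
      split_ifs with hh
      · rfl
      · by_contra hne
        exact hh (hGsub fun hc => hne (hc s hs))
    rw [this]
    exact Measurable.ite hGm measurable_const (haem s hs).measurable_mk
  refine ⟨⟨_, hmeas⟩, ⟨hprob⟩, ?_⟩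
  have : ∀ᵐ h ∂l, h ∉ G := measure_eq_zero_iff_ae_notMem.1 hG0
  filter_upwards [this] with h hh
  simp [hh]

theorem IsInducedBy.isProbabilityMeasure {M : Model X A₁ A₂} {p₀ : Measure X}
    [IsProbabilityMeasure p₀] {π₁ : Policy₁ M} {π₂ : Policy₂ M} {P : Measure (Path X A₁ A₂)}
    (h : IsInducedBy M p₀ π₁ π₂ P) : IsProbabilityMeasure P :=
  ⟨by simpa using h.init univ MeasurableSet.univ⟩

theorem measurable_mul_aux {Y : Type*} {m : MeasurableSpace Y} {f g : Y → ℝ≥0∞}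
    (hf : Measurable f) (hg : Measurable g) : Measurable fun y => f y * g y := hf.mul hg

/-- The product of the action probabilities of the two players, as a function of the history. -/
theorem measurable_actionProb {M : Model X A₁ A₂} (π₁ : Policy₁ M) (π₂ : Policy₂ M) (n : ℕ)
    {C₁ : Set A₁} {C₂ : Set A₂} (h₁ : MeasurableSet C₁) (h₂ : MeasurableSet C₂) :
    @Measurable _ ℝ≥0∞ (univSigma (Hist X (A₁ × A₂) n)) _
      (fun h => (π₁.kernel n).toFun h.info C₁ * (π₂.kernel n).toFun h C₂) :=
  measurable_mul_aux (((π₁.kernel n).comap Hist.info measurable_info).meas C₁ h₁)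
    ((π₂.kernel n).meas C₂ h₂)

/-- The law determined by the initial distribution and the policies is unique. -/
theorem IsInducedBy.unique {M : Model X A₁ A₂} {p₀ : Measure X} [IsProbabilityMeasure p₀]
    {π₁ : Policy₁ M} {π₂ : Policy₂ M} {P P' : Measure (Path X A₁ A₂)}
    (h : IsInducedBy M p₀ π₁ π₂ P) (h' : IsInducedBy M p₀ π₁ π₂ P') : P = P' := by
  have hP := h.isProbabilityMeasure
  have hP' := h'.isProbabilityMeasure
  have stepA : ∀ n, P.map (Path.hist n) = P'.map (Path.hist n) →
      P.map (Path.hist' n) = P'.map (Path.hist' n) := by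
    intro n hn
    have key : P.map (fun ω => (Path.hist n ω, (ω n).2.1, (ω n).2.2)) =
        P'.map (fun ω => (Path.hist n ω, (ω n).2.1, (ω n).2.2)) := by
      have hm : Measurable (fun ω : Path X A₁ A₂ => (Path.hist n ω, (ω n).2.1, (ω n).2.2)) :=
        (measurable_hist n).prodMk (by fun_prop)
      have : IsFiniteMeasure (P.map (fun ω => (Path.hist n ω, (ω n).2.1, (ω n).2.2))) :=
        inferInstance
      refine Measure.ext_prod₃ fun {B C₁ C₂} hB h₁ h₂ => ?_
      rw [Measure.map_apply hm (hB.prod (h₁.prod h₂)), Measure.map_apply hm (hB.prod (h₁.prod h₂))]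
      have e : ∀ Q : Measure (Path X A₁ A₂), IsProbabilityMeasure Q → IsInducedBy M p₀ π₁ π₂ Q →
          Q ((fun ω : Path X A₁ A₂ => (Path.hist n ω, (ω n).2.1, (ω n).2.2)) ⁻¹' B ×ˢ C₁ ×ˢ C₂) =
          ∫⁻ z in B, (π₁.kernel n).toFun z.info C₁ * (π₂.kernel n).toFun z C₂
            ∂(Q.map (Path.hist n)) := by
        intro Q hQ hi
        have hQm : IsProbabilityMeasure (Q.map (Path.hist n)) :=
          Measure.isProbabilityMeasure_map (measurable_hist n).aemeasurable
        have := hi.action n B C₁ C₂ hB h₁ h₂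
        rw [Measure.restrict_map (measurable_hist n) hB, lintegral_map']
        · exact this
        · rw [← Measure.restrict_map (measurable_hist n) hB]
          exact (aemeasurable_of_univSigma (measurable_actionProb π₁ π₂ n h₁ h₂) _).restrict
        · exact (measurable_hist n).aemeasurable
      rw [e P hP h, e P' hP' h', hn]
    have hg : Measurable (fun y : Hist X (A₁ × A₂) n × A₁ × A₂ =>
        (Fin.snoc y.1.1 (y.1.2, y.2) : Fin (n + 1) → X × A₁ × A₂)) := by
      refine measurable_pi_iff.2 fun i => ?_
      refine Fin.lastCases ?_ (fun j => ?_) i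
      · simp only [Fin.snoc_last]; fun_prop
      · simp only [Fin.snoc_castSucc]; fun_prop
    have hfac : (Path.hist' n : Path X A₁ A₂ → _) =
        (fun y : Hist X (A₁ × A₂) n × A₁ × A₂ =>
          (Fin.snoc y.1.1 (y.1.2, y.2) : Fin (n + 1) → X × A₁ × A₂)) ∘
        (fun ω => (Path.hist n ω, (ω n).2.1, (ω n).2.2)) := by
      funext ω i
      refine Fin.lastCases ?_ (fun j => ?_) i
      · simp [Path.hist', Path.hist]
      · simp [Path.hist', Path.hist]
    rw [hfac, ← Measure.map_map hg ((measurable_hist n).prodMk (by fun_prop)), key,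
      Measure.map_map hg ((measurable_hist n).prodMk (by fun_prop))]
  have stepB : ∀ n, P.map (Path.hist' n) = P'.map (Path.hist' n) →
      P.map (Path.hist (n + 1)) = P'.map (Path.hist (n + 1)) := by
    intro n hn
    have hm : Measurable (Path.hist (n + 1) : Path X A₁ A₂ → _) := measurable_hist (n + 1)
    refine Measure.ext_prod fun {B D} hB hD => ?_
    rw [Measure.map_apply hm (hB.prod hD), Measure.map_apply hm (hB.prod hD)]
    have e : ∀ Q : Measure (Path X A₁ A₂), IsInducedBy M p₀ π₁ π₂ Q →
        Q ((Path.hist (n + 1)) ⁻¹' B ×ˢ D) =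
        ∫⁻ z in B, M.q (z (Fin.last n)) D ∂(Q.map (Path.hist' n)) := by
      intro Q hi
      have := hi.trans n B D hB hD
      rw [Measure.restrict_map (measurable_hist' n) hB, lintegral_map]
      · exact this
      · exact (Kernel.measurable_coe M.q hD).comp (by fun_prop)
      · exact measurable_hist' n
    rw [e P h, e P' h', hn]
  have h0 : P.map (Path.hist 0) = P'.map (Path.hist 0) := by
    have hm : Measurable (Path.hist 0 : Path X A₁ A₂ → _) := measurable_hist 0
    refine Measure.ext_prod fun {B D} hB hD => ?_
    rw [Measure.map_apply hm (hB.prod hD), Measure.map_apply hm (hB.prod hD)]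
    by_cases hb : (default : Fin 0 → X × A₁ × A₂) ∈ B
    · have hs : (Path.hist 0 : Path X A₁ A₂ → _) ⁻¹' B ×ˢ D = {ω | (ω 0).1 ∈ D} := by
        ext ω
        have : (Path.hist 0 ω).1 = default := Subsingleton.elim _ _
        simp only [mem_preimage, mem_prod, this, hb, true_and]
        rfl
      rw [hs, h.init D hD, h'.init D hD]
    · have hs : (Path.hist 0 : Path X A₁ A₂ → _) ⁻¹' B ×ˢ D = ∅ := by
        ext ω
        have : (Path.hist 0 ω).1 = default := Subsingleton.elim _ _
        simp only [mem_preimage, mem_prod, this, hb, false_and]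
        simp
      rw [hs, measure_empty, measure_empty]
  have hist_eq : ∀ n, P.map (Path.hist n) = P'.map (Path.hist n) := by
    intro n
    induction n with
    | zero => exact h0
    | succ n ih => exact stepB n (stepA n ih)
  have hist'_eq := fun n => stepA n (hist_eq n)
  refine IsProjectiveLimit.unique (P := fun I => P.map I.restrict) (fun _ => rfl) fun I => ?_
  have hg : Measurable (fun (y : Fin (I.sup id + 1) → X × A₁ × A₂) (i : I) =>
      y ⟨i, Nat.lt_succ_of_le (Finset.le_sup (f := id) i.2)⟩) := by fun_prop
  have hfac : (I.restrict : Path X A₁ A₂ → _) =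
      (fun (y : Fin (I.sup id + 1) → X × A₁ × A₂) (i : I) =>
      y ⟨i, Nat.lt_succ_of_le (Finset.le_sup (f := id) i.2)⟩) ∘ Path.hist' (I.sup id) := by
    funext ω i
    rfl
  rw [hfac, ← Measure.map_map hg (measurable_hist' _), ← hist'_eq,
    Measure.map_map hg (measurable_hist' _), ← hfac]

/-- Laws of the coordinate at time `0` for a trajectory measure. -/
theorem map_zero_trajMeasure {Z : Type*} [MeasurableSpace Z] (m : Measure Z)
    [IsProbabilityMeasure m] (K : (n : ℕ) → Kernel (Finset.Iic n → Z) Z)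
    [∀ n, IsMarkovKernel (K n)] :
    (Kernel.trajMeasure (X := fun _ => Z) m K).map (Preorder.frestrictLe 0) =
      m.map (MeasurableEquiv.piUnique (fun _ : Finset.Iic 0 => Z)).symm := by
  rw [Kernel.trajMeasure, Measure.map_comp _ _ (by fun_prop), Kernel.traj_map_frestrictLe,
    Kernel.partialTraj_self, Measure.id_comp]

/-- Ionescu-Tulcea for kernels that are chosen one after the other, depending on the law of the
trajectory so far. -/
theorem exists_traj {Z : Type*} [MeasurableSpace Z] (m₀ : Measure Z) [IsProbabilityMeasure m₀]
    (R : (n : ℕ) → Measure (Finset.Iic n → Z) → Kernel (Finset.Iic n → Z) Z → Prop)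
    (hR : ∀ n m, IsProbabilityMeasure m → ∃ K, IsMarkovKernel K ∧ R n m K) :
    ∃ (P : Measure (ℕ → Z)) (K : (n : ℕ) → Kernel (Finset.Iic n → Z) Z),
      IsProbabilityMeasure P ∧ P.map (fun ω => ω 0) = m₀ ∧
      ∀ n, IsMarkovKernel (K n) ∧ R n (P.map (Preorder.frestrictLe n)) (K n) ∧
        P.map (fun ω => (Preorder.frestrictLe n ω, ω (n + 1))) =
          P.map (Preorder.frestrictLe n) ⊗ₘ K n := by
  choose k hk using fun n (m : {m : Measure (Finset.Iic n → Z) // IsProbabilityMeasure m}) =>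
    hR n m.1 m.2
  let snoc : (n : ℕ) → (Finset.Iic n → Z) × Z → (Finset.Iic (n + 1) → Z) := fun n y i =>
    if h : i.1 ≤ n then y.1 ⟨i.1, Finset.mem_Iic.2 h⟩ else y.2
  have hsnoc : ∀ n, Measurable (snoc n) := by
    intro n
    refine measurable_pi_iff.2 fun i => ?_
    by_cases h : i.1 ≤ n
    · simp only [snoc, h, dite_true]; fun_prop
    · simp only [snoc, h, dite_false]; fun_prop
  have hprob : ∀ n (m : {m : Measure (Finset.Iic n → Z) // IsProbabilityMeasure m}),
      IsProbabilityMeasure ((m.1 ⊗ₘ k n m).map (snoc n)) := by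
    intro n m
    have := m.2
    have := (hk n m).1
    exact Measure.isProbabilityMeasure_map (hsnoc n).aemeasurable
  have hprob0 : IsProbabilityMeasure
      (m₀.map (MeasurableEquiv.piUnique (fun _ : Finset.Iic 0 => Z)).symm) :=
    Measure.isProbabilityMeasure_map (MeasurableEquiv.measurable _).aemeasurable
  let m : (n : ℕ) → {m : Measure (Finset.Iic n → Z) // IsProbabilityMeasure m} := fun n =>
    Nat.rec ⟨_, hprob0⟩ (fun n m => ⟨_, hprob n m⟩) n
  let K : (n : ℕ) → Kernel (Finset.Iic n → Z) Z := fun n => k n (m n)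
  have hK : ∀ n, IsMarkovKernel (K n) := fun n => (hk n (m n)).1
  set P := Kernel.trajMeasure (X := fun _ => Z) m₀ K with hP
  have hstep : ∀ n, P.map (fun ω => (Preorder.frestrictLe n ω, ω (n + 1))) =
      P.map (Preorder.frestrictLe n) ⊗ₘ K n := fun n =>
    (Kernel.map_frestrictLe_trajMeasure_compProd_eq_map_trajMeasure (X := fun _ => Z)
      (μ₀ := m₀) (κ := K) (a := n)).symm
  have hmarg : ∀ n, P.map (Preorder.frestrictLe n) = (m n).1 := by
    intro n
    induction n with
    | zero => exact map_zero_trajMeasure m₀ K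
    | succ n ih =>
      have hfac : (Preorder.frestrictLe (n + 1) : (ℕ → Z) → _) =
          snoc n ∘ fun ω => (Preorder.frestrictLe n ω, ω (n + 1)) := by
        funext ω i
        by_cases h : i.1 ≤ n
        · simp [snoc, h]
        · have hi : i.1 = n + 1 := le_antisymm (Finset.mem_Iic.1 i.2) (by omega)
          simp [snoc, hi]
      rw [hfac, ← Measure.map_map (hsnoc n) (by fun_prop), hstep n, ih]
  refine ⟨P, K, inferInstance, ?_, fun n => ⟨hK n, ?_, hstep n⟩⟩
  · have hfac : (fun ω : ℕ → Z => ω 0) =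
        (MeasurableEquiv.piUnique (fun _ : Finset.Iic 0 => Z)) ∘ Preorder.frestrictLe 0 := by
      funext ω
      rfl
    rw [hfac, ← Measure.map_map (MeasurableEquiv.measurable _) (by fun_prop),
      map_zero_trajMeasure, MeasurableEquiv.map_map_symm]
  · rw [hmarg n]
    exact (hk n (m n)).2

theorem exists_actionVersion [MeasurableSpace.CountablyGenerated A₁]
    [MeasurableSpace.CountablyGenerated A₂] {M : Model X A₁ A₂} (π₁ : Policy₁ M) (π₂ : Policy₂ M)
    (n : ℕ) (l : Measure (Hist X (A₁ × A₂) n)) [IsProbabilityMeasure l] :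
    ∃ κ : Kernel (Hist X (A₁ × A₂) n) (A₁ × A₂), IsMarkovKernel κ ∧
      ∀ᵐ h ∂l, ∀ (C₁ : Set A₁) (C₂ : Set A₂),
        κ h (C₁ ×ˢ C₂) = (π₁.kernel n).toFun h.info C₁ * (π₂.kernel n).toFun h C₂ := by
  obtain ⟨η₁, h₁, e₁⟩ := ((π₁.kernel n).comap Hist.info measurable_info).exists_version l
  obtain ⟨η₂, h₂, e₂⟩ := (π₂.kernel n).exists_version l
  refine ⟨η₁ ×ₖ η₂, inferInstance, ?_⟩
  filter_upwards [e₁, e₂] with h he₁ he₂ C₁ C₂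
  rw [Kernel.prod_apply, Measure.prod_prod, he₁, he₂]
  rfl

theorem action_of_compProd {M : Model X A₁ A₂} (π₁ : Policy₁ M) (π₂ : Policy₂ M) (n : ℕ)
    (P : Measure (Path X A₁ A₂)) [IsProbabilityMeasure P] {Y : Type*} [MeasurableSpace Y]
    (U : Path X A₁ A₂ → Y) (hU : Measurable U) (g : Y → Hist X (A₁ × A₂) n) (hg : Measurable g)
    (hgU : ∀ ω, Path.hist n ω = g (U ω))
    (κ : Kernel (Hist X (A₁ × A₂) n) (A₁ × A₂)) [IsMarkovKernel κ]
    (hP : P.map (fun ω => (U ω, (ω n).2)) = P.map U ⊗ₘ κ.comap g hg)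
    (e : ∀ᵐ h ∂((P.map U).map g), ∀ (C₁ : Set A₁) (C₂ : Set A₂),
        κ h (C₁ ×ˢ C₂) = (π₁.kernel n).toFun h.info C₁ * (π₂.kernel n).toFun h C₂)
    (B : Set (Hist X (A₁ × A₂) n)) (C₁ : Set A₁) (C₂ : Set A₂)
    (hB : MeasurableSet B) (h₁ : MeasurableSet C₁) (h₂ : MeasurableSet C₂) :
    P {ω | Path.hist n ω ∈ B ∧ (ω n).2.1 ∈ C₁ ∧ (ω n).2.2 ∈ C₂} =
      ∫⁻ ω in {ω | Path.hist n ω ∈ B},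
        (π₁.kernel n).toFun (Path.info n ω) C₁ * (π₂.kernel n).toFun (Path.hist n ω) C₂ ∂P := by
  have hPU : IsProbabilityMeasure (P.map U) := Measure.isProbabilityMeasure_map hU.aemeasurable
  have hset : {ω : Path X A₁ A₂ | Path.hist n ω ∈ B ∧ (ω n).2.1 ∈ C₁ ∧ (ω n).2.2 ∈ C₂} =
      (fun ω => (U ω, (ω n).2)) ⁻¹' ((g ⁻¹' B) ×ˢ (C₁ ×ˢ C₂)) := by
    ext ω
    simp [hgU]
  have hset' : {ω : Path X A₁ A₂ | Path.hist n ω ∈ B} = U ⁻¹' (g ⁻¹' B) := by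
    ext ω
    simp [hgU]
  rw [hset, ← Measure.map_apply (by fun_prop) ((hg hB).prod (h₁.prod h₂)), hP,
    Measure.compProd_apply_prod (hg hB) (h₁.prod h₂), Measure.restrict_map hU (hg hB),
    lintegral_map (Kernel.measurable_coe _ (h₁.prod h₂)) hU, hset']
  refine lintegral_congr_ae (ae_restrict_of_ae ?_)
  filter_upwards [ae_of_ae_map hU.aemeasurable (ae_of_ae_map hg.aemeasurable e)] with ω hω
  rw [Kernel.comap_apply, hω C₁ C₂, ← hgU]
  rfl

/-- The law determined by the initial distribution and the policies exists. -/
theorem IsInducedBy.exists [MeasurableSpace.CountablyGenerated A₁]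
    [MeasurableSpace.CountablyGenerated A₂] (M : Model X A₁ A₂) (p₀ : Measure X)
    [IsProbabilityMeasure p₀] (π₁ : Policy₁ M) (π₂ : Policy₂ M) :
    ∃ P : Measure (Path X A₁ A₂), IsInducedBy M p₀ π₁ π₂ P := by
  have hMk := M.markov
  -- the history of length `n + 1` as a function of the stages `0, …, n` and the next state
  let g : (n : ℕ) → (Finset.Iic n → X × A₁ × A₂) × X → Hist X (A₁ × A₂) (n + 1) := fun n y =>
    (fun i => y.1 ⟨i, Finset.mem_Iic.2 (Nat.lt_succ_iff.1 i.2)⟩, y.2)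
  have hg : ∀ n, Measurable (g n) := fun n => by fun_prop
  let last : (n : ℕ) → (Finset.Iic n → X × A₁ × A₂) → X × A₁ × A₂ := fun n y =>
    y ⟨n, Finset.mem_Iic.2 le_rfl⟩
  have hlast : ∀ n, Measurable (last n) := fun n => by fun_prop
  let qc : (n : ℕ) → Kernel (Finset.Iic n → X × A₁ × A₂) X := fun n => M.q.comap (last n) (hlast n)
  have hqc : ∀ n, IsMarkovKernel (qc n) := fun n => inferInstance
  let R : (n : ℕ) → Measure (Finset.Iic n → X × A₁ × A₂) →
      Kernel (Finset.Iic n → X × A₁ × A₂) (X × A₁ × A₂) → Prop := fun n m K =>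
    ∃ κ : Kernel (Hist X (A₁ × A₂) (n + 1)) (A₁ × A₂), IsMarkovKernel κ ∧
      K = qc n ⊗ₖ κ.comap (g n) (hg n) ∧
      ∀ᵐ h ∂((m ⊗ₘ qc n).map (g n)), ∀ (C₁ : Set A₁) (C₂ : Set A₂),
        κ h (C₁ ×ˢ C₂) = (π₁.kernel (n + 1)).toFun h.info C₁ * (π₂.kernel (n + 1)).toFun h C₂
  have hR : ∀ n m, IsProbabilityMeasure m → ∃ K, IsMarkovKernel K ∧ R n m K := by
    intro n m hm
    have : IsProbabilityMeasure ((m ⊗ₘ qc n).map (g n)) :=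
      Measure.isProbabilityMeasure_map (hg n).aemeasurable
    obtain ⟨κ, hκ, e⟩ := exists_actionVersion π₁ π₂ (n + 1) ((m ⊗ₘ qc n).map (g n))
    exact ⟨_, inferInstance, κ, hκ, rfl, e⟩
  -- the first stage
  let g₀ : X → Hist X (A₁ × A₂) 0 := fun x => (default, x)
  have hg₀ : Measurable g₀ := by fun_prop
  have hp : IsProbabilityMeasure (p₀.map g₀) := Measure.isProbabilityMeasure_map hg₀.aemeasurable
  obtain ⟨κ₀, hκ₀, e₀⟩ := exists_actionVersion π₁ π₂ 0 (p₀.map g₀)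
  obtain ⟨P, K, hP, hP0, hPK⟩ := exists_traj (p₀ ⊗ₘ κ₀.comap g₀ hg₀) R hR
  have hmarg0 : P.map (fun ω => (ω 0).1) = p₀ := by
    have : (fun ω : Path X A₁ A₂ => (ω 0).1) = Prod.fst ∘ fun ω => ω 0 := rfl
    rw [this, ← Measure.map_map (by fun_prop) (by fun_prop), hP0]
    exact Measure.fst_compProd _ _
  have hnext : ∀ n, P.map (fun ω => (Preorder.frestrictLe n ω, (ω (n + 1)).1)) =
      P.map (Preorder.frestrictLe n) ⊗ₘ qc n := by
    intro n
    obtain ⟨hKm, ⟨κ, hκ, rfl_K, -⟩, hK⟩ := hPK n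
    have hPm : IsProbabilityMeasure (P.map (Preorder.frestrictLe (π := fun _ => X × A₁ × A₂) n)) :=
      Measure.isProbabilityMeasure_map (by fun_prop)
    have : (fun ω : Path X A₁ A₂ => (Preorder.frestrictLe (π := fun _ => X × A₁ × A₂) n ω,
        (ω (n + 1)).1)) = (Prod.fst ∘ MeasurableEquiv.prodAssoc.symm) ∘
        fun ω => (Preorder.frestrictLe (π := fun _ => X × A₁ × A₂) n ω, ω (n + 1)) := rfl
    rw [this, ← Measure.map_map (by fun_prop) (by fun_prop), hK, rfl_K,
      ← Measure.map_map (by fun_prop) (by fun_prop), Measure.compProd_assoc]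
    exact Measure.fst_compProd _ _
  refine ⟨P, ⟨fun D hD => ?_, fun n B C₁ C₂ hB h₁ h₂ => ?_, fun n B D hB hD => ?_⟩⟩
  · rw [← hmarg0, Measure.map_apply (by fun_prop) hD]
    rfl
  · cases n with
    | zero =>
      refine action_of_compProd π₁ π₂ 0 P (fun ω => (ω 0).1) (by fun_prop) g₀ hg₀ ?_ κ₀ ?_ ?_
        B C₁ C₂ hB h₁ h₂
      · intro ω
        exact Prod.ext (Subsingleton.elim _ _) rfl
      · rw [hmarg0]
        exact hP0
      · rw [hmarg0]
        exact e₀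
    | succ n =>
      obtain ⟨hKm, ⟨κ, hκ, rfl_K, e⟩, hK⟩ := hPK n
      refine action_of_compProd π₁ π₂ (n + 1) P
        (fun ω => (Preorder.frestrictLe (π := fun _ => X × A₁ × A₂) n ω, (ω (n + 1)).1))
        (by fun_prop) (g n) (hg n) ?_ κ ?_ ?_ B C₁ C₂ hB h₁ h₂
      · intro ω
        rfl
      · have : (fun ω : Path X A₁ A₂ => ((Preorder.frestrictLe (π := fun _ => X × A₁ × A₂) n ω,
          (ω (n + 1)).1), (ω (n + 1)).2)) = MeasurableEquiv.prodAssoc.symm ∘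
          fun ω => (Preorder.frestrictLe (π := fun _ => X × A₁ × A₂) n ω, ω (n + 1)) := rfl
        rw [this, ← Measure.map_map (by fun_prop) (by fun_prop), hK, rfl_K,
          Measure.compProd_assoc, hnext]
      · rw [hnext]
        exact e
  · have hPm : IsProbabilityMeasure (P.map (Preorder.frestrictLe (π := fun _ => X × A₁ × A₂) n)) :=
      Measure.isProbabilityMeasure_map (by fun_prop)
    let s : (Finset.Iic n → X × A₁ × A₂) → Fin (n + 1) → X × A₁ × A₂ := fun y i =>
      y ⟨i, Finset.mem_Iic.2 (Nat.lt_succ_iff.1 i.2)⟩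
    have hs : Measurable s := by fun_prop
    have h1 : P {ω | Path.hist' n ω ∈ B ∧ (ω (n + 1)).1 ∈ D} =
        P.map (fun ω => (Preorder.frestrictLe (π := fun _ => X × A₁ × A₂) n ω, (ω (n + 1)).1))
          ((s ⁻¹' B) ×ˢ D) := by
      rw [Measure.map_apply (by fun_prop) ((hs hB).prod hD)]
      rfl
    rw [h1, hnext, Measure.compProd_apply_prod (hs hB) hD,
      Measure.restrict_map (by fun_prop) (hs hB),
      lintegral_map (Kernel.measurable_coe _ hD) (by fun_prop)]
    rfl

end Policies

section Control

variable {X : Type u} {A₁ : Type v} {A₂ : Type w}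
  [MeasurableSpace X] [MeasurableSpace A₁] [MeasurableSpace A₂]
  [StandardBorelSpace X] [StandardBorelSpace A₁] [StandardBorelSpace A₂]

/-- The law `ρ_{p₀}[π₁, π₂]` on `Ω` induced by a policy pair and an initial distribution. -/
def inducedLaw (M : Model X A₁ A₂) (p₀ : ProbabilityMeasure X) (π₁ : Policy₁ M) (π₂ : Policy₂ M) :
    ProbabilityMeasure (Path X A₁ A₂) :=
  ⟨(IsInducedBy.exists M p₀.toMeasure π₁ π₂).choose,
    (IsInducedBy.exists M p₀.toMeasure π₁ π₂).choose_spec.isProbabilityMeasure⟩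

theorem inducedLaw_spec (M : Model X A₁ A₂) (p₀ : ProbabilityMeasure X) (π₁ : Policy₁ M)
    (π₂ : Policy₂ M) : IsInducedBy M p₀.toMeasure π₁ π₂ (inducedLaw M p₀ π₁ π₂).toMeasure :=
  (IsInducedBy.exists M p₀.toMeasure π₁ π₂).choose_spec

/-- The law `ρ_x[π₁, π₂]` for the initial state `x`. -/
def inducedLawFrom (M : Model X A₁ A₂) (x : X) (π₁ : Policy₁ M) (π₂ : Policy₂ M) :
    ProbabilityMeasure (Path X A₁ A₂) :=
  inducedLaw M ⟨Measure.dirac x, inferInstance⟩ π₁ π₂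

/-- The marginal on `I_n` of the law induced by a policy pair and the initial state `x`. -/
def infoMarginal (M : Model X A₁ A₂) (x : X) (π₁ : Policy₁ M) (π₂ : Policy₂ M) (n : ℕ) :
    Measure (Hist X A₁ n) :=
  (inducedLawFrom M x π₁ π₂).toMeasure.map (Path.info n)

/-- Absolute continuity assumption: for a fixed policy of player 1, the marginals on `I_n` obtained
with any two policies of player 2 are mutually absolutely continuous. -/
def AbsContAssumption (M : Model X A₁ A₂) : Prop :=
  ∀ (π₁ : Policy₁ M) (π₂ π₂' : Policy₂ M) (x : X) (n : ℕ),
    infoMarginal M x π₁ π₂ n ≪ infoMarginal M x π₁ π₂' n ∧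
      infoMarginal M x π₁ π₂' n ≪ infoMarginal M x π₁ π₂ n

/-- Measurability assumption on the criterion: it is an upper semianalytic function of the induced
law. Here the `σ`-algebra on the space of laws is the one generated by the evaluations
`p ↦ p(B)`, which is the Borel `σ`-algebra of the topology of weak convergence. -/
def CriterionAssumption (M : Model X A₁ A₂) (J : Policy₁ M → Policy₂ M → X → EReal) : Prop :=
  ∃ φ : ProbabilityMeasure (Path X A₁ A₂) → EReal, UpperSemianalytic φ ∧
    ∀ (x : X) (π₁ : Policy₁ M) (π₂ : Policy₂ M), J π₁ π₂ x = φ (inducedLawFrom M x π₁ π₂)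

end Control

/-- The `ε`-best-response level of player 2 against `π₁` at the state `x`: the supremum of the
criterion minus `ε` if the supremum is less than `+∞`, and `1/ε` otherwise. -/
def responseLevel {X : Type u} {Pol₁ : Type v} {Pol₂ : Type w} (J : Pol₁ → Pol₂ → X → EReal)
    (ε : ℝ) (π₁ : Pol₁) (x : X) : EReal :=
  if (⨆ π₂ : Pol₂, J π₁ π₂ x) < ⊤ then (⨆ π₂ : Pol₂, J π₁ π₂ x) - (ε : EReal)
  else ((1 / ε : ℝ) : EReal)

end Minimax

end

noncomputable section

namespace Minimax

universe u v w

open Filter Topology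

/-! ### Universal measurability of analytic sets -/

/-! The idea is to code the behaviour of player 1 by a law on paths. Fix any policy `πbar₂`, and for
z = (ĩ₁, x) let S(z) be the law from x of the shifted `πbar₁` against `πbar₂`. By the absolute
continuity assumption, every law obtained from x against the same shifted policy has its marginals
on I_n dominated by those of S(z). The conditional law of player 1's action given i_n, read off from
S(z), is therefore correct almost surely under all these laws. Hence the attainable laws are exactly
the ρ with `Consistent M (S z) ρ`, a relation between two laws that no longer mentions policies.

This relation is analytic (`isAnalytic_consistent`): regular conditional laws can be chosen jointly
Borel in the law and the conditioning value (`condLaw`), so every condition is Borel except the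
admissibility of player 2's actions, which is analytic. Jankov–von Neumann selection
(`IsAnalytic.exists_section`, `exists_nearOptimal_section`) then gives a universally measurable ψ
such that ψ(m) nearly maximizes φ over the laws consistent with m. The selection is made in the
variable m and S is substituted afterwards: S is only universally measurable
(`measurable_of_isInducedBy`), which is enough for the composition ψ ∘ S but would not directly make
the constraint set analytic in z.

Finally the laws ψ(S(z)) are turned into one policy (`responsePolicy`): after the first stage,
player 2 reads z off the history and acts by the conditional law of his action under ψ(S(z)). His
shifted policies induce exactly these laws (`isInducedBy_responsePolicy`), by uniqueness of the law
of a policy pair. -/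

theorem isCompact_Iic_nat (k : ℕ → ℕ) : IsCompact (Iic k) := by
  have : Iic k = Set.pi univ fun i => Iic (k i) := by
    ext α
    simp [Pi.le_def]
  rw [this]
  exact isCompact_univ_pi fun i => (Set.finite_Iic (k i)).isCompact

/-- A sequence whose coordinates are eventually bounded by `k` has a subsequence which converges to a
point of the box `{α | α ≤ k}`. -/
theorem exists_subseq_tendsto_of_le_prefix (k : ℕ → ℕ) (a : ℕ → ℕ → ℕ)
    (ha : ∀ n, ∀ i < n, a n i ≤ k i) :
    ∃ b ∈ Iic k, ∃ φ : ℕ → ℕ, StrictMono φ ∧ Tendsto (a ∘ φ) atTop (𝓝 b) := by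
  obtain ⟨b, hb, φ, hφ, hlim⟩ := (isCompact_Iic_nat k).tendsto_subseq (x := fun n i => min (a n i) (k i))
    (fun n i => min_le_right _ _)
  refine ⟨b, hb, φ, hφ, tendsto_pi_nhds.2 fun i => ?_⟩
  refine (tendsto_pi_nhds.1 hlim i).congr' ?_
  filter_upwards [eventually_gt_atTop i] with n hn
  exact min_eq_left (ha _ i (hn.trans_le (hφ.id_le n)))

/-- A continuous image of the Baire space is inner regular with respect to compact sets. -/
theorem exists_isCompact_lt_measure_range {X : Type u} [TopologicalSpace X] [MeasurableSpace X]
    (μ : Measure X) [μ.OuterRegular] {f : (ℕ → ℕ) → X} (hf : Continuous f) {c : ℝ≥0∞}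
    (hc : c < μ (range f)) : ∃ K, IsCompact K ∧ K ⊆ range f ∧ c ≤ μ K := by
  have step : ∀ (n : ℕ) (T : {T : Set (ℕ → ℕ) // c < μ (f '' T)}),
      ∃ j : ℕ, c < μ (f '' (T.1 ∩ {α | α n ≤ j})) := by
    intro n T
    have hU : f '' T.1 = ⋃ j : ℕ, f '' (T.1 ∩ {α | α n ≤ j}) := by
      rw [← image_iUnion, ← inter_iUnion]
      congr 1
      refine (inter_eq_left.2 fun α _ => ?_).symm
      exact mem_iUnion.2 ⟨α n, by simp⟩
    have hmono : Monotone fun j : ℕ => f '' (T.1 ∩ {α | α n ≤ j}) := fun i j hij =>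
      image_mono (inter_subset_inter_right _ fun α (hα : α n ≤ i) => hα.trans hij)
    have h := T.2
    -- Continuity from below holds for increasing sequences of arbitrary sets, so the images need
    -- not be measurable.
    rw [hU, hmono.measure_iUnion] at h
    exact lt_iSup_iff.1 h
  choose j hj using step
  -- The digits are bounded one at a time, keeping the outer measure of the image above `c`.
  let T : ℕ → {T : Set (ℕ → ℕ) // c < μ (f '' T)} := fun n =>
    Nat.rec ⟨univ, by rwa [image_univ]⟩ (fun n T => ⟨_, hj n T⟩) n
  set k : ℕ → ℕ := fun n => j n (T n) with hk
  have hT : ∀ n, (T n).1 = {α | ∀ i < n, α i ≤ k i} := by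
    intro n
    induction n with
    | zero => simp [T]
    | succ n ih =>
      have : (T (n + 1)).1 = (T n).1 ∩ {α | α n ≤ k n} := rfl
      rw [this, ih]
      ext α
      simp only [mem_inter_iff, mem_ofPred_eq, Nat.forall_lt_succ_right]
  refine ⟨f '' Iic k, (isCompact_Iic_nat k).image hf, image_subset_range _ _, ?_⟩
  rw [Set.measure_eq_iInf_isOpen]
  refine le_iInf₂ fun U hKU => le_iInf fun hU => ?_
  -- Otherwise there are points of each `T n` mapped outside `U`. A subsequence converges to a point
  -- of `Iic k`, whose image lies in the open set `U`.
  obtain ⟨n, hn⟩ : ∃ n, (T n).1 ⊆ f ⁻¹' U := by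
    by_contra! hcon
    choose a ha haU using fun n => not_subset.1 (hcon n)
    obtain ⟨b, hb, φ, -, hlim⟩ := exists_subseq_tendsto_of_le_prefix k a
      fun n => by simpa [hT] using ha n
    have hbU : f ⁻¹' U ∈ 𝓝 b := (hU.preimage hf).mem_nhds (hKU (mem_image_of_mem f hb))
    obtain ⟨n, hn⟩ := (hlim.eventually hbU).exists
    exact haU _ hn
  exact (T n).2.le.trans (measure_mono (image_subset_iff.2 hn))

/-- Analytic sets are measurable with respect to the completion of any finite Borel measure. -/
theorem AnalyticSet.nullMeasurableSet {X : Type u} [TopologicalSpace X] [PolishSpace X]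
    [MeasurableSpace X] [BorelSpace X] {s : Set X} (hs : AnalyticSet s) (μ : Measure X)
    [IsFiniteMeasure μ] : NullMeasurableSet s μ := by
  let _ := TopologicalSpace.upgradeIsCompletelyMetrizable X
  rw [AnalyticSet] at hs
  obtain rfl | ⟨f, hf, rfl⟩ := hs
  · exact nullMeasurableSet_empty
  by_cases h0 : μ (range f) = 0
  · exact NullMeasurableSet.of_null h0
  -- Compact subsets of measure at least `c n`, with `c n` increasing to the outer measure, exhaust
  -- the range up to a null set.
  obtain ⟨c, -, hcl, hct⟩ := exists_seq_strictMono_tendsto' (pos_iff_ne_zero.2 h0)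
  choose K hK hKf hcK using fun n => exists_isCompact_lt_measure_range μ hf (hcl n).2
  have hm : MeasurableSet (⋃ n, K n) := MeasurableSet.iUnion fun n => (hK n).measurableSet
  refine ⟨⋃ n, K n, hm, (ae_eq_of_subset_of_measure_ge (iUnion_subset hKf) ?_
    hm.nullMeasurableSet (measure_ne_top _ _)).symm⟩
  exact le_of_tendsto' hct fun n => (hcK n).trans (measure_mono (subset_iUnion K n))

/-- Analytic subsets of a standard Borel space are universally measurable. -/
theorem IsAnalytic.measurableSet_univSigma {X : Type u} [MeasurableSpace X] [StandardBorelSpace X]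
    {s : Set X} (hs : IsAnalytic s) : MeasurableSet[univSigma X] s := by
  obtain ⟨Y, _, _, f, hf, rfl⟩ := hs
  let _ := upgradeStandardBorel X
  intro p
  rw [← image_univ]
  exact AnalyticSet.nullMeasurableSet (MeasurableSet.univ.analyticSet_image hf) _

/-! ### Universally measurable sections -/

section LexSection

variable {X : Type u} (f : (ℕ → ℕ) → X)

/-- The first `n` digits of the lexicographically least point of the fibre of `f`. -/
def lexPrefix (x : X) : (n : ℕ) → Fin n → ℕ
  | 0 => Fin.elim0
  | n + 1 => Fin.snoc (lexPrefix x n)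
      (sInf {k | ∃ α, f α = x ∧ (∀ i : Fin n, α i = lexPrefix x n i) ∧ α n = k})

/-- The lexicographically least point of the fibre of `f`. -/
def lexSection (x : X) : ℕ → ℕ := fun n => lexPrefix f x (n + 1) (Fin.last n)

theorem lexPrefix_apply (x : X) (n : ℕ) (i : Fin n) : lexPrefix f x n i = lexSection f x i := by
  induction n with
  | zero => exact i.elim0
  | succ n ih =>
    refine Fin.lastCases rfl (fun i => ?_) i
    rw [lexPrefix, Fin.snoc_castSucc, ih]
    rfl

/-- The infimum of a nonempty set of naturals is attained, so each least prefix still extends to a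
point of the fibre. -/
theorem exists_lexPrefix {x : X} (hx : x ∈ range f) (n : ℕ) :
    ∃ α, f α = x ∧ ∀ i : Fin n, α i = lexPrefix f x n i := by
  induction n with
  | zero =>
    obtain ⟨α, rfl⟩ := hx
    exact ⟨α, rfl, fun i => i.elim0⟩
  | succ n ih =>
    obtain ⟨α, hα, h⟩ := ih
    obtain ⟨β, hβ, hn, hk⟩ := Nat.sInf_mem
      (s := {k | ∃ α, f α = x ∧ (∀ i : Fin n, α i = lexPrefix f x n i) ∧ α n = k})
      ⟨α n, α, hα, h, rfl⟩
    refine ⟨β, hβ, fun i => ?_⟩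
    refine Fin.lastCases ?_ (fun i => ?_) i
    · rw [lexPrefix, Fin.snoc_last]
      exact hk
    · rw [lexPrefix, Fin.snoc_castSucc]
      exact hn i

/-- Fibre points that agree with `lexSection f x` on their first n digits converge to it, and the
fibre of a continuous map into a Hausdorff space is closed. -/
theorem apply_lexSection [TopologicalSpace X] [T2Space X] {f : (ℕ → ℕ) → X} (hf : Continuous f)
    {x : X} (hx : x ∈ range f) : f (lexSection f x) = x := by
  choose α hα h using exists_lexPrefix f hx
  have hlim : Tendsto α atTop (𝓝 (lexSection f x)) := by
    refine tendsto_pi_nhds.2 fun i => ?_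
    refine tendsto_const_nhds.congr' ?_
    filter_upwards [eventually_gt_atTop i] with n hn
    rw [h n ⟨i, hn⟩, lexPrefix_apply]
  refine tendsto_nhds_unique ((hf.tendsto _).comp hlim) ?_
  simp [Function.comp_def, hα]

/-- Each digit is a minimum of naturals decided by membership in images of cylinders. The σ-algebra
on `X` is arbitrary, so that the universal one can be used, for which the images, being analytic,
are measurable. -/
theorem measurable_lexSection [MeasurableSpace X]
    (hE : ∀ (n : ℕ) (s : Fin n → ℕ), MeasurableSet (f '' {α | ∀ i : Fin n, α i = s i})) :
    Measurable (lexSection f) := by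
  have hE' : ∀ (n : ℕ) (s : Fin n → ℕ) (k : ℕ),
      MeasurableSet {x | ∃ α, f α = x ∧ (∀ i : Fin n, α i = s i) ∧ α n = k} := by
    intro n s k
    convert hE (n + 1) (Fin.snoc s k) using 1
    ext x
    simp only [mem_ofPred_eq, mem_image, Fin.forall_fin_succ', Fin.val_castSucc, Fin.snoc_castSucc,
      Fin.val_last, Fin.snoc_last]
    exact exists_congr fun α => and_comm
  have hinf : ∀ (n : ℕ) (s : Fin n → ℕ), Measurable fun x =>
      sInf {k | ∃ α, f α = x ∧ (∀ i : Fin n, α i = s i) ∧ α n = k} := by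
    intro n s
    refine measurable_to_countable' fun k => ?_
    have : (fun x => sInf {k | ∃ α, f α = x ∧ (∀ i : Fin n, α i = s i) ∧ α n = k}) ⁻¹' {k} =
        {x | (x ∈ f '' {α | ∀ i : Fin n, α i = s i} ∧
          (∃ α, f α = x ∧ (∀ i : Fin n, α i = s i) ∧ α n = k) ∧
          ∀ j < k, ¬ ∃ α, f α = x ∧ (∀ i : Fin n, α i = s i) ∧ α n = j) ∨
          (x ∉ f '' {α | ∀ i : Fin n, α i = s i} ∧ k = 0)} := by
      ext x
      simp only [mem_preimage, mem_singleton_iff, mem_ofPred_eq]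
      by_cases hx : x ∈ f '' {α | ∀ i : Fin n, α i = s i}
      · simp only [hx, true_and, not_true_eq_false, false_and, or_false]
        obtain ⟨α, hα, rfl⟩ := hx
        have hne : {k | ∃ β, f β = f α ∧ (∀ i : Fin n, β i = s i) ∧ β n = k}.Nonempty :=
          ⟨α n, α, rfl, hα, rfl⟩
        constructor
        · rintro rfl
          exact ⟨Nat.sInf_mem hne, fun j hj => Nat.notMem_of_lt_sInf hj⟩
        · rintro ⟨h1, h2⟩
          exact le_antisymm (Nat.sInf_le h1) (not_lt.1 fun hlt => h2 _ hlt (Nat.sInf_mem hne))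
      · simp only [hx, false_and, not_false_eq_true, true_and, false_or]
        have : {k | ∃ α, f α = x ∧ (∀ i : Fin n, α i = s i) ∧ α n = k} = ∅ := by
          refine eq_empty_of_forall_notMem fun k hk => hx ?_
          obtain ⟨α, h1, h2, -⟩ := hk
          exact ⟨α, h2, h1⟩
        rw [this, Nat.sInf_empty]
        exact eq_comm
    rw [this]
    refine MeasurableSet.union (MeasurableSet.inter (hE n s) (MeasurableSet.inter (hE' n s k) ?_))
      (MeasurableSet.inter (hE n s).compl (MeasurableSet.const _))
    change MeasurableSet
      {x | ∀ j < k, ¬ ∃ α, f α = x ∧ (∀ i : Fin n, α i = s i) ∧ α n = j}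
    have : {x | ∀ j < k, ¬ ∃ α, f α = x ∧ (∀ i : Fin n, α i = s i) ∧ α n = j} =
        ⋂ j, ⋂ _ : j < k, {x | ∃ α, f α = x ∧ (∀ i : Fin n, α i = s i) ∧ α n = j}ᶜ := by
      ext x
      simp only [mem_iInter, mem_compl_iff, mem_ofPred_eq]
    rw [this]
    exact MeasurableSet.iInter fun j => MeasurableSet.iInter fun _ => (hE' n s j).compl
  have hpre : ∀ n, Measurable fun x => lexPrefix f x n := by
    intro n
    induction n with
    | zero => exact measurable_pi_iff.2 fun i => i.elim0
    | succ n ih =>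
      have hl : Measurable fun x =>
          sInf {k | ∃ α, f α = x ∧ (∀ i : Fin n, α i = lexPrefix f x n i) ∧ α n = k} := by
        -- There are countably many prefixes, so measurability for each fixed prefix gives joint
        -- measurability, and the prefix may then depend on `x`.
        have := (measurable_from_prod_countable_left (f := fun y : X × (Fin n → ℕ) =>
          sInf {k | ∃ α, f α = y.1 ∧ (∀ i : Fin n, α i = y.2 i) ∧ α n = k}) (hinf n)).comp
          (measurable_id.prodMk ih)
        exact this
      refine measurable_pi_iff.2 fun i => ?_
      refine Fin.lastCases ?_ (fun i => ?_) i
      · simpa only [lexPrefix, Fin.snoc_last] using hl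
      · simp only [lexPrefix, Fin.snoc_castSucc]
        exact (measurable_pi_apply i).comp ih
  exact measurable_pi_iff.2 fun n => (measurable_pi_apply (Fin.last n)).comp (hpre (n + 1))

end LexSection

/-- The **Jankov–von Neumann selection theorem**. -/
theorem IsAnalytic.exists_section {X : Type u} {Y : Type v} [MeasurableSpace X]
    [StandardBorelSpace X] [MeasurableSpace Y] [Nonempty Y] {s : Set (X × Y)}
    (hs : IsAnalytic s) :
    ∃ ψ : X → Y, @Measurable X Y (univSigma X) _ ψ ∧ ∀ x y, (x, y) ∈ s → (x, ψ x) ∈ s := by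
  obtain ⟨W, mW, _, F, hF, rfl⟩ := hs
  obtain hW | hW := isEmpty_or_nonempty W
  · refine ⟨fun _ => Classical.arbitrary Y, @measurable_const _ _ _ (univSigma X) _,
      fun x y h => ?_⟩
    obtain ⟨w, -⟩ := h
    exact hW.elim w
  let _ := upgradeStandardBorel X
  let tW := upgradeStandardBorel W
  -- A finer Polish topology with the same Borel sets makes the first coordinate of `F` continuous.
  -- Parametrizing it by the Baire space reduces the problem to the lexicographic section.
  obtain ⟨t', ht', hcont, hpol⟩ := (measurable_fst.comp hF).exists_continuous
  obtain ⟨c, hc, hsurj⟩ := @PolishSpace.exists_nat_nat_continuous_surjective W t' hpol hW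
  have hcm : Measurable c := by
    have hb : mW = @borel W t' := by
      rw [eq_borel_upgradeStandardBorel W]
      exact (@borel_eq_borel_of_le W t' tW.toTopologicalSpace hpol tW.toPolishSpace ht').symm
    have := @Continuous.borel_measurable _ _ _ t' c hc
    rw [← hb, ← BorelSpace.measurable_eq] at this
    exact this
  set f : (ℕ → ℕ) → X := fun α => (F (c α)).1 with hfdef
  have hf : Continuous f := @Continuous.comp _ _ _ _ t' _ _ _ hcont hc
  refine ⟨fun x => (F (c (lexSection f x))).2, ?_, fun x y h => ?_⟩
  · refine (measurable_snd.comp (hF.comp hcm)).comp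
      (@measurable_lexSection X f (univSigma X) fun n s p => ?_)
    refine AnalyticSet.nullMeasurableSet (AnalyticSet.image_of_continuous ?_ hf) _
    refine IsClosed.analyticSet ?_
    simp only [ofPred_forall]
    exact isClosed_iInter fun i => isClosed_eq (continuous_apply _) continuous_const
  · obtain ⟨w, hw⟩ := h
    obtain ⟨α, rfl⟩ := hsurj w
    have h1 : f (lexSection f x) = x := apply_lexSection hf ⟨α, by rw [hfdef]; simp [hw]⟩
    exact ⟨c (lexSection f x), Prod.ext h1 rfl⟩

/-! ### Universally measurable maps -/

section UnivMeasurable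

variable {X : Type u} {Y : Type v} {Z : Type w} [MeasurableSpace X] [MeasurableSpace Y]
  [MeasurableSpace Z]

theorem le_univSigma : ‹MeasurableSpace X› ≤ univSigma X := fun _ hs _ => hs.nullMeasurableSet

theorem _root_.Measurable.univSigma {f : X → Y} (hf : Measurable f) :
    @Measurable X Y (univSigma X) _ f :=
  hf.mono le_univSigma le_rfl

theorem aemeasurable_of_measurable_univSigma [MeasurableSpace.CountablyGenerated Y] {f : X → Y}
    (hf : @Measurable X Y (univSigma X) _ f) (p : Measure X) [IsProbabilityMeasure p] :
    AEMeasurable f p :=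
  NullMeasurable.aemeasurable fun _ hs => hf hs ⟨p, inferInstance⟩

/-- A universally measurable map is measurable between the universal `σ`-algebras. -/
theorem measurable_univSigma_univSigma [MeasurableSpace.CountablyGenerated Y] {f : X → Y}
    (hf : @Measurable X Y (univSigma X) _ f) :
    @Measurable X Y (univSigma X) (univSigma Y) f := by
  intro s hs p
  -- Up to a `p`-null set `f` is a Borel map, and `s` is null measurable for the push-forward of `p`
  -- along that map.
  have hae := aemeasurable_of_measurable_univSigma hf p.toMeasure
  have h1 := (hs (p.map hae.measurable_mk.aemeasurable)).preimage
    (hae.measurable_mk.quasiMeasurePreserving p.toMeasure)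
  refine h1.congr ?_
  filter_upwards [hae.ae_eq_mk] with x hx
  change (hae.mk f x ∈ s) = (f x ∈ s)
  rw [hx]

theorem measurable_univSigma_comp [MeasurableSpace.CountablyGenerated Y] {f : X → Y} {g : Y → Z}
    (hg : @Measurable Y Z (univSigma Y) _ g) (hf : @Measurable X Y (univSigma X) _ f) :
    @Measurable X Z (univSigma X) _ (fun x => g (f x)) :=
  @Measurable.comp X Y Z (univSigma X) (univSigma Y) _ _ _ hg (measurable_univSigma_univSigma hf)

end UnivMeasurable

/-! ### The space of probability measures is standard Borel -/

theorem standardBorelSpace_of_measurableEquiv {X : Type u} {Y : Type v} [MeasurableSpace X]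
    [MeasurableSpace Y] [StandardBorelSpace Y] (e : X ≃ᵐ Y) : StandardBorelSpace X := by
  let _ := upgradeStandardBorel Y
  let _ : TopologicalSpace X := TopologicalSpace.induced e inferInstance
  have hind : IsInducing e := ⟨rfl⟩
  refine ⟨inferInstance, ⟨?_⟩, ?_⟩
  · rw [← e.measurableEmbedding.comap_eq]
    exact (congrArg (MeasurableSpace.comap e.toEquiv) (eq_borel_upgradeStandardBorel Y)).trans
      borel_comap.symm
  · exact (e.toEquiv.toHomeomorphOfIsInducing hind).isClosedEmbedding.polishSpace

/-- A measurable retract of a standard Borel space is standard Borel. -/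
theorem standardBorelSpace_of_leftInverse {X : Type u} {Y : Type v} [MeasurableSpace X]
    [MeasurableSpace Y] [StandardBorelSpace Y] {g : X → Y} {r : Y → X} (hg : Measurable g)
    (hr : Measurable r) (h : Function.LeftInverse r g) : StandardBorelSpace X := by
  -- The range of `g` is the set of fixed points of `g ∘ r`, hence Borel.
  have hS : MeasurableSet {y | g (r y) = y} := measurableSet_eq_fun (hg.comp hr) measurable_id
  have := hS.standardBorel
  exact standardBorelSpace_of_measurableEquiv (Y := {y | g (r y) = y})
    { toFun := fun x => ⟨g x, by simp [h x]⟩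
      invFun := fun y => r y
      left_inv := h
      right_inv := fun y => Subtype.ext y.2
      measurable_toFun := hg.subtype_mk (h := fun x => by simp [h x])
      measurable_invFun := hr.comp measurable_subtype_coe }

section ProbabilityMeasure

variable {X : Type u} {Y : Type v} [MeasurableSpace X] [MeasurableSpace Y]

theorem measurable_toMeasure : Measurable (ProbabilityMeasure.toMeasure (Ω := X)) :=
  measurable_subtype_coe

theorem measurable_probabilityMeasure_iff {f : Y → ProbabilityMeasure X} :
    Measurable f ↔ Measurable fun y => (f y).toMeasure :=
  ⟨fun h => measurable_toMeasure.comp h, fun h => h.subtype_mk⟩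

/-- Push-forward along a measurable map, as a map of probability measures. -/
def pushforward {f : X → Y} (hf : Measurable f) (p : ProbabilityMeasure X) :
    ProbabilityMeasure Y := p.map hf.aemeasurable

theorem toMeasure_pushforward {f : X → Y} (hf : Measurable f) (p : ProbabilityMeasure X) :
    (pushforward hf p).toMeasure = p.toMeasure.map f := rfl

theorem measurable_pushforward {f : X → Y} (hf : Measurable f) : Measurable (pushforward hf) :=
  measurable_probabilityMeasure_iff.2 ((Measure.measurable_map f hf).comp measurable_toMeasure)

theorem pushforward_pushforward {Z : Type w} [MeasurableSpace Z] {f : X → Y} (hf : Measurable f)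
    {g : Y → Z} (hg : Measurable g) (p : ProbabilityMeasure X) :
    pushforward hg (pushforward hf p) = pushforward (hg.comp hf) p :=
  Subtype.ext (Measure.map_map hg hf)

/-- A law on the line is coded by the values of its distribution function at the rationals. The
decoding map `r` is defined on all of `ℚ → ℝ`, so the laws form a measurable retract. -/
theorem standardBorelSpace_probabilityMeasure_real :
    StandardBorelSpace (ProbabilityMeasure ℝ) := by
  have hid : Measurable (id : (ℚ → ℝ) → ℚ → ℝ) := measurable_id
  have hcdf := isMeasurableRatCDF_toRatCDF hid
  let r : (ℚ → ℝ) → ProbabilityMeasure ℝ := fun f =>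
    ⟨(hcdf.stieltjesFunction f).measure, inferInstance⟩
  refine standardBorelSpace_of_leftInverse (Y := ℚ → ℝ)
    (g := fun p q => cdf p.toMeasure (q : ℝ)) (r := r) ?_ ?_ ?_
  · refine measurable_pi_iff.2 fun q => ?_
    simp_rw [cdf_eq_real]
    exact ((Measure.measurable_coe measurableSet_Iic).comp measurable_toMeasure).ennreal_toReal
  · exact measurable_probabilityMeasure_iff.2 hcdf.measurable_measure_stieltjesFunction
  · intro p
    have hp : IsRatStieltjesPoint (id : (ℚ → ℝ) → ℚ → ℝ) (fun q => cdf p.toMeasure (q : ℝ)) := by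
      refine ⟨fun a b hab => monotone_cdf _ (by exact_mod_cast hab),
        (tendsto_cdf_atTop _).comp (tendsto_ratCast_atTop_iff.2 tendsto_id),
        (tendsto_cdf_atBot _).comp (tendsto_ratCast_atBot_iff.2 tendsto_id), fun t => ?_⟩
      rw [id, ← StieltjesFunction.iInf_rat_gt_eq (cdf p.toMeasure) (t : ℝ)]
      exact Equiv.iInf_congr (Equiv.subtypeEquivRight fun q => by simp) fun q => rfl
    refine Subtype.ext ?_
    change (hcdf.stieltjesFunction _).measure = p.toMeasure
    conv_rhs => rw [← measure_cdf p.toMeasure]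
    congr 1
    ext x
    rw [← StieltjesFunction.iInf_rat_gt_eq, ← StieltjesFunction.iInf_rat_gt_eq (cdf p.toMeasure)]
    refine iInf_congr fun q => ?_
    rw [hcdf.stieltjesFunction_eq, toRatCDF_of_isRatStieltjesPoint hp]
    rfl

/-- Embed `X` measurably in the line with a measurable left inverse; push-forward makes the laws on
`X` a retract of the laws on the line. -/
instance standardBorelSpace_probabilityMeasure [StandardBorelSpace X] :
    StandardBorelSpace (ProbabilityMeasure X) := by
  have := standardBorelSpace_probabilityMeasure_real
  obtain hX | hX := isEmpty_or_nonempty X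
  · have : IsEmpty (ProbabilityMeasure X) := ⟨fun p =>
      hX.elim (nonempty_of_isProbabilityMeasure p.toMeasure).some⟩
    infer_instance
  have he := measurableEmbedding_embeddingReal X
  obtain ⟨r, hr, hre⟩ := he.exists_measurable_extend measurable_id fun _ => hX
  refine standardBorelSpace_of_leftInverse (measurable_pushforward he.measurable)
    (measurable_pushforward hr) fun p => ?_
  rw [pushforward_pushforward]
  refine Subtype.ext ?_
  rw [← ProbabilityMeasure.toMeasure]
  simp [toMeasure_pushforward, hre]

end ProbabilityMeasure

/-! ### Closure properties of analytic sets -/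

section Analytic

variable {X : Type u} {Y : Type v} [MeasurableSpace X] [MeasurableSpace Y]

theorem IsAnalytic.of_analyticSet [TopologicalSpace X] [BorelSpace X] {s : Set X}
    (hs : AnalyticSet s) : IsAnalytic s := by
  rw [AnalyticSet] at hs
  obtain rfl | ⟨f, hf, rfl⟩ := hs
  · exact ⟨Empty, inferInstance, inferInstance, Empty.elim, measurable_from_top,
      range_eq_empty _⟩
  · exact ⟨ℕ → ℕ, inferInstance, inferInstance, f, hf.measurable, rfl⟩

theorem IsAnalytic.analyticSet [TopologicalSpace X] [PolishSpace X] [BorelSpace X] {s : Set X}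
    (hs : IsAnalytic s) : AnalyticSet s := by
  obtain ⟨W, _, _, f, hf, rfl⟩ := hs
  rw [← image_univ]
  exact MeasurableSet.univ.analyticSet_image hf

theorem IsAnalytic.of_measurableSet [StandardBorelSpace X] {s : Set X} (hs : MeasurableSet s) :
    IsAnalytic s := by
  let _ := upgradeStandardBorel X
  exact .of_analyticSet hs.analyticSet

theorem IsAnalytic.iInter [StandardBorelSpace X] {ι : Type*} [Countable ι] [Nonempty ι]
    {s : ι → Set X} (hs : ∀ i, IsAnalytic (s i)) : IsAnalytic (⋂ i, s i) := by
  let _ := upgradeStandardBorel X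
  exact .of_analyticSet (AnalyticSet.iInter fun i => (hs i).analyticSet)

theorem IsAnalytic.inter [StandardBorelSpace X] {s t : Set X} (hs : IsAnalytic s)
    (ht : IsAnalytic t) : IsAnalytic (s ∩ t) := by
  rw [inter_eq_iInter]
  exact .iInter fun b => by cases b <;> assumption

theorem IsAnalytic.image {s : Set X} (hs : IsAnalytic s) {f : X → Y} (hf : Measurable f) :
    IsAnalytic (f '' s) := by
  obtain ⟨W, _, _, g, hg, rfl⟩ := hs
  exact ⟨W, inferInstance, inferInstance, f ∘ g, hf.comp hg, range_comp f g⟩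

/-- Refining the Polish topology of `X` without changing its Borel sets makes `f` continuous. -/
theorem IsAnalytic.preimage [StandardBorelSpace X] [StandardBorelSpace Y] {s : Set Y}
    (hs : IsAnalytic s) {f : X → Y} (hf : Measurable f) : IsAnalytic (f ⁻¹' s) := by
  let _ := upgradeStandardBorel Y
  let tX := upgradeStandardBorel X
  obtain ⟨t', ht', hcont, hpol⟩ := hf.exists_continuous
  have hb : @BorelSpace X t' _ := ⟨by
    rw [eq_borel_upgradeStandardBorel X]
    exact (@borel_eq_borel_of_le X t' tX.toTopologicalSpace hpol tX.toPolishSpace ht').symm⟩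
  exact @IsAnalytic.of_analyticSet X _ t' hb _ (@AnalyticSet.preimage _ _ t' _ hpol _ _
    hs.analyticSet _ hcont)

/-- The probability measures carried by an analytic set form an analytic set. -/
theorem IsAnalytic.setOf_measure_eq_one [StandardBorelSpace X] {s : Set X} (hs : IsAnalytic s) :
    IsAnalytic {p : ProbabilityMeasure X | p.toMeasure s = 1} := by
  obtain ⟨W, _, _, f, hf, hfs⟩ := id hs
  refine ⟨ProbabilityMeasure W, inferInstance, inferInstance, pushforward hf,
    measurable_pushforward hf, ?_⟩
  ext p
  simp only [mem_range, mem_ofPred_eq]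
  constructor
  · rintro ⟨p, rfl⟩
    -- The set `s` need not be Borel, so its measure is computed on a measurable hull.
    rw [toMeasure_pushforward, ← measure_toMeasurable,
      Measure.map_apply hf (measurableSet_toMeasurable _ _)]
    rw [preimage_eq_univ_iff.2, measure_univ]
    rw [hfs]
    exact subset_toMeasurable _ _
  · intro hp
    have hW : Nonempty W := by
      by_contra hW
      rw [not_nonempty_iff] at hW
      rw [← hfs, range_eq_empty, measure_empty] at hp
      exact zero_ne_one hp
    -- A universally measurable right inverse `σ` of `f` on `s` lifts `p` to a law on `W` whose
    -- push-forward is `p` again.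
    have hG : IsAnalytic {z : X × W | f z.2 = z.1} := ⟨W, inferInstance, inferInstance,
      fun w => (f w, w), by fun_prop, by
        ext ⟨x, w⟩
        simp [Prod.ext_iff]⟩
    obtain ⟨σ, hσ, hfσ⟩ := hG.exists_section
    have hae := aemeasurable_of_measurable_univSigma hσ p.toMeasure
    refine ⟨p.map hae, Subtype.ext ?_⟩
    change (p.toMeasure.map σ).map f = p.toMeasure
    rw [AEMeasurable.map_map_of_aemeasurable hf.aemeasurable hae]
    conv_rhs => rw [← Measure.map_id (μ := p.toMeasure)]
    refine Measure.map_congr ?_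
    have hnull : p.toMeasure sᶜ = 0 :=
      (prob_compl_eq_zero_iff₀ (hs.measurableSet_univSigma p)).2 hp
    filter_upwards [measure_eq_zero_iff_ae_notMem.1 hnull] with x hx
    obtain ⟨w, rfl⟩ : x ∈ range f := by
      rw [hfs]
      exact not_not.1 hx
    exact hfσ (f w) w rfl

end Analytic

/-! ### Measurable `ε`-optimal selection -/

/-- The level `s - ε` if `s < +∞`, and `1/ε` otherwise. -/
def nearLevel (ε : ℝ) (s : EReal) : EReal :=
  if s < ⊤ then s - (ε : EReal) else ((1 / ε : ℝ) : EReal)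

theorem nearLevel_le_iff {ε : ℝ} {s : EReal} {q : ℝ} :
    nearLevel ε s ≤ q ↔ (s < ⊤ ∧ s ≤ ((q + ε : ℝ) : EReal)) ∨ (s = ⊤ ∧ 1 / ε ≤ q) := by
  unfold nearLevel
  split_ifs with h
  · simp only [h, true_and, h.ne, false_and, or_false]
    rw [EReal.sub_le_iff_le_add (by simp) (by simp), EReal.coe_add]
  · have : s = ⊤ := not_lt_top_iff.1 h
    simp [this]

/-- This lets countably many level sets suffice. The value `⊥` is excluded because nothing lies
strictly below it. -/
theorem exists_rat_nearLevel_le_lt {ε : ℝ} (hε : 0 < ε) {s : EReal} (hs : s ≠ ⊥) :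
    ∃ q : ℚ, nearLevel ε s ≤ ((q : ℝ) : EReal) ∧ ((q : ℝ) : EReal) < s := by
  induction s using EReal.rec with
  | bot => exact absurd rfl hs
  | coe s =>
    obtain ⟨q, h1, h2⟩ := exists_rat_btwn (sub_lt_self s hε)
    refine ⟨q, nearLevel_le_iff.2 (Or.inl ⟨EReal.coe_lt_top _, ?_⟩), by exact_mod_cast h2⟩
    exact_mod_cast (by linarith : s ≤ q + ε)
  | top =>
    obtain ⟨q, h1⟩ := exists_rat_gt (1 / ε)
    exact ⟨q, nearLevel_le_iff.2 (Or.inr ⟨rfl, h1.le⟩), EReal.coe_lt_top _⟩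

/-- The supremum of `φ` over the fibre of `D` at `x`. -/
def fibreSup {X : Type u} {Y : Type v} (D : Set (X × Y)) (φ : Y → EReal) (x : X) : EReal :=
  ⨆ (y : Y) (_ : (x, y) ∈ D), φ y

theorem lt_fibreSup_iff {X : Type u} {Y : Type v} {D : Set (X × Y)} {φ : Y → EReal} {x : X}
    {c : EReal} : c < fibreSup D φ x ↔ ∃ y, (x, y) ∈ D ∧ c < φ y := by
  simp [fibreSup, lt_iSup_iff]

/-- At `x` take the first rational q, in a fixed enumeration, that lies above the required level and
is reached by `φ` on the fibre, and use `σ q`. If there is none, the supremum is `⊥` and any point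
of the fibre will do. The σ-algebra on `X` is left free for use with the universal one. -/
theorem exists_measurable_nearOptimal_of_sections {X : Type u} {Y : Type v} [MeasurableSpace X]
    [MeasurableSpace Y] {D : Set (X × Y)} {φ : Y → EReal} {ε : ℝ} (hε : 0 < ε)
    (hE : ∀ q : ℚ, MeasurableSet {x | ∃ y, (x, y) ∈ D ∧ ((q : ℝ) : EReal) ≤ φ y})
    (σ : ℚ → X → Y) (hσ : ∀ q, Measurable (σ q))
    (hσD : ∀ (q : ℚ) x, (∃ y, (x, y) ∈ D ∧ ((q : ℝ) : EReal) ≤ φ y) →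
      (x, σ q x) ∈ D ∧ ((q : ℝ) : EReal) ≤ φ (σ q x))
    (σ₀ : X → Y) (hσ₀ : Measurable σ₀) (hσ₀D : ∀ x, (∃ y, (x, y) ∈ D) → (x, σ₀ x) ∈ D) :
    ∃ ψ : X → Y, Measurable ψ ∧ ∀ x, (∃ y, (x, y) ∈ D) →
      (x, ψ x) ∈ D ∧ nearLevel ε (fibreSup D φ x) ≤ φ (ψ x) := by
  classical
  have hs : Measurable (fibreSup D φ) := by
    refine measurable_of_Ioi fun c => ?_
    have : fibreSup D φ ⁻¹' Ioi c = ⋃ (q : ℚ) (_ : c < ((q : ℝ) : EReal)),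
        {x | ∃ y, (x, y) ∈ D ∧ ((q : ℝ) : EReal) ≤ φ y} := by
      ext x
      simp only [mem_preimage, mem_Ioi, lt_fibreSup_iff, mem_iUnion, mem_ofPred_eq, exists_prop]
      constructor
      · rintro ⟨y, hy, hc⟩
        obtain ⟨q, h1, h2⟩ := EReal.lt_iff_exists_rat_btwn.1 hc
        exact ⟨q, h1, y, hy, h2.le⟩
      · rintro ⟨q, hc, y, hy, hq⟩
        exact ⟨y, hy, hc.trans_le hq⟩
    rw [this]
    exact .iUnion fun q => .iUnion fun _ => hE q
  let q : ℕ → ℚ := (Denumerable.eqv ℚ).symm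
  let G : ℕ → Set X := fun n => {x | ∃ y, (x, y) ∈ D ∧ ((q n : ℝ) : EReal) ≤ φ y} ∩
    {x | nearLevel ε (fibreSup D φ x) ≤ ((q n : ℝ) : EReal)}
  have hG : ∀ n, MeasurableSet (G n) := by
    intro n
    refine (hE (q n)).inter ?_
    simp only [nearLevel_le_iff]
    refine MeasurableSet.union (MeasurableSet.inter ?_ ?_) (MeasurableSet.inter ?_ (.const _))
    · exact hs measurableSet_Iio
    · exact hs measurableSet_Iic
    · exact hs (measurableSet_singleton ⊤)
  have hN : MeasurableSet (⋃ n, G n)ᶜ := (MeasurableSet.iUnion hG).compl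
  -- Adding the exceptional set to every `G n` makes the search for the first index total.
  have hex : ∀ x, ∃ n, x ∈ G n ∪ (⋃ n, G n)ᶜ := by
    intro x
    by_cases hx : x ∈ ⋃ n, G n
    · obtain ⟨n, hn⟩ := mem_iUnion.1 hx
      exact ⟨n, Or.inl hn⟩
    · exact ⟨0, Or.inr hx⟩
  refine ⟨fun x => (⋃ n, G n)ᶜ.piecewise σ₀ (σ (q (Nat.find (hex x)))) x,
    Measurable.find (p := fun n x => x ∈ G n ∪ (⋃ n, G n)ᶜ) (fun n => hσ₀.piecewise hN (hσ (q n))) (fun n => (hG n).union hN) hex,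
    fun x hx => ?_⟩
  by_cases hxN : x ∈ (⋃ n, G n)ᶜ
  · have hbot : fibreSup D φ x = ⊥ := by
      by_contra hne
      obtain ⟨r, h1, h2⟩ := exists_rat_nearLevel_le_lt hε hne
      obtain ⟨y, hy, hry⟩ := lt_fibreSup_iff.1 h2
      refine hxN (mem_iUnion.2 ⟨Denumerable.eqv ℚ r, ?_⟩)
      have : q (Denumerable.eqv ℚ r) = r := Equiv.symm_apply_apply _ _
      exact ⟨⟨y, hy, by rw [this]; exact hry.le⟩, by rw [mem_ofPred_eq, this]; exact h1⟩
    beta_reduce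
    rw [piecewise_eq_of_mem _ _ _ hxN]
    refine ⟨hσ₀D x hx, ?_⟩
    rw [hbot]
    simp [nearLevel]
  · beta_reduce
    rw [piecewise_eq_of_notMem _ _ _ hxN]
    obtain ⟨h1, h2⟩ := (Nat.find_spec (hex x)).resolve_right hxN
    obtain ⟨h3, h4⟩ := hσD _ _ h1
    exact ⟨h3, le_trans h2 h4⟩

/-- Universally measurable `ε`-optimal selection for an upper semianalytic function. -/
theorem exists_nearOptimal_section {X : Type u} {Y : Type v} [MeasurableSpace X]
    [StandardBorelSpace X] [MeasurableSpace Y] [StandardBorelSpace Y] [Nonempty Y]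
    {D : Set (X × Y)} (hD : IsAnalytic D) {φ : Y → EReal} (hφ : UpperSemianalytic φ) {ε : ℝ}
    (hε : 0 < ε) :
    ∃ ψ : X → Y, @Measurable X Y (univSigma X) _ ψ ∧ ∀ x, (∃ y, (x, y) ∈ D) →
      (x, ψ x) ∈ D ∧ nearLevel ε (fibreSup D φ x) ≤ φ (ψ x) := by
  have hDq : ∀ q : ℚ, IsAnalytic (D ∩ Prod.snd ⁻¹' {y | ((q : ℝ) : EReal) ≤ φ y}) := fun q =>
    hD.inter ((hφ q).preimage measurable_snd)
  choose σ hσ hσD using fun q => (hDq q).exists_section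
  obtain ⟨σ₀, hσ₀, hσ₀D⟩ := hD.exists_section
  refine @exists_measurable_nearOptimal_of_sections X Y (univSigma X) _ D φ ε hε (fun q => ?_)
    σ hσ (fun q x ⟨y, hy⟩ => hσD q x y hy) σ₀ hσ₀ (fun x ⟨y, hy⟩ => hσ₀D x y hy)
  -- Projections of analytic sets are analytic, hence universally measurable.
  convert! ((hDq q).image measurable_fst).measurableSet_univSigma using 1
  ext x
  simp

/-! ### Universally measurable families of laws -/

theorem measurable_univSigma_of_aemeasurable {X : Type u} {Y : Type v} [MeasurableSpace X]
    [MeasurableSpace Y] {f : X → Y}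
    (hf : ∀ p : Measure X, IsProbabilityMeasure p → AEMeasurable f p) :
    @Measurable X Y (univSigma X) _ f :=
  fun _ hs p => (hf p.toMeasure inferInstance).nullMeasurable hs

/-- Integration against a universally measurable kernel. -/
theorem UnivKernel.measurable_lintegral {Z : Type u} {H : Type v} [MeasurableSpace Z]
    [MeasurableSpace H] [MeasurableSpace.CountablyGenerated H] (T : UnivKernel Z H)
    {g : Z × H → ℝ≥0∞} (hg : @Measurable _ _ (univSigma (Z × H)) _ g) :
    @Measurable Z ℝ≥0∞ (univSigma Z) _ (fun z => ∫⁻ h, g (z, h) ∂T.toFun z) := by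
  refine measurable_univSigma_of_aemeasurable fun p hp => ?_
  -- Under a fixed `p`, replace `T` by a Borel version `η`, and then `g` by a Borel version with
  -- respect to `p ⊗ₘ η`.
  obtain ⟨η, hη, e⟩ := T.exists_version p
  have hga := aemeasurable_of_univSigma hg (p ⊗ₘ η)
  refine ⟨fun z => ∫⁻ h, hga.mk g (z, h) ∂η z, hga.measurable_mk.lintegral_kernel_prod_right', ?_⟩
  filter_upwards [e, Measure.ae_ae_of_ae_compProd hga.ae_eq_mk] with z hz hgz
  rw [← hz]
  exact lintegral_congr_ae hgz

/-- The law of `f` depends in a universally measurable way on the parameter. -/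
def UnivMeasurableLaw {Z : Type u} {Ω : Type v} {E : Type w} [MeasurableSpace Z]
    [MeasurableSpace Ω] [MeasurableSpace E] (P : Z → ProbabilityMeasure Ω) (f : Ω → E) : Prop :=
  ∀ S, MeasurableSet S → @Measurable Z ℝ≥0∞ (univSigma Z) _ fun z => (P z).toMeasure (f ⁻¹' S)

namespace UnivMeasurableLaw

variable {Z : Type u} {Ω : Type v} {E : Type w} [MeasurableSpace Z]
    [MeasurableSpace Ω] [MeasurableSpace E] {P : Z → ProbabilityMeasure Ω} {f : Ω → E}

theorem comp {E' : Type*} [MeasurableSpace E'] (h : UnivMeasurableLaw P f) {g : E → E'}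
    (hg : Measurable g) : UnivMeasurableLaw P (fun ω => g (f ω)) := fun _ hS => h _ (hg hS)

theorem of_isPiSystem (hf : Measurable f) {C : Set (Set E)}
    (hC : ‹MeasurableSpace E› = MeasurableSpace.generateFrom C) (hpi : IsPiSystem C)
    (h : ∀ S ∈ C, @Measurable Z ℝ≥0∞ (univSigma Z) _ fun z => (P z).toMeasure (f ⁻¹' S)) :
    UnivMeasurableLaw P f := by
  have hprob : ∀ z, IsProbabilityMeasure ((P z).toMeasure.map f) := fun z =>
    Measure.isProbabilityMeasure_map hf.aemeasurable
  have hm : @Measurable Z (Measure E) (univSigma Z) _ fun z => (P z).toMeasure.map f := by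
    refine @Measurable.measure_of_isPiSystem_of_isProbabilityMeasure Z E (univSigma Z) _ _ hprob
      C hC hpi fun S hS => ?_
    have hSm : MeasurableSet S := by
      rw [hC]
      exact MeasurableSpace.measurableSet_generateFrom hS
    simpa only [Measure.map_apply hf hSm] using h S hS
  intro S hS
  have := (Measure.measurable_coe hS).comp hm
  simpa only [Function.comp_def, Measure.map_apply hf hS] using this

/-- The family of laws as a universally measurable kernel. -/
def kernel (h : UnivMeasurableLaw P f) (hf : Measurable f) : UnivKernel Z E where
  toFun z := (P z).toMeasure.map f
  prob z := Measure.isProbabilityMeasure_map hf.aemeasurable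
  meas S hS := by simpa only [Measure.map_apply hf hS] using h S hS

/-- These are the integrals on the right-hand sides of the identities defining an induced law. -/
theorem measurable_setLIntegral [MeasurableSpace.CountablyGenerated E]
    (h : UnivMeasurableLaw P f) (hf : Measurable f) {g : Z × E → ℝ≥0∞}
    (hg : @Measurable _ _ (univSigma (Z × E)) _ g) {B : Set E} (hB : MeasurableSet B) :
    @Measurable Z ℝ≥0∞ (univSigma Z) _ fun z => ∫⁻ ω in f ⁻¹' B, g (z, f ω) ∂(P z).toMeasure := by
  have hB' : MeasurableSet[univSigma (Z × E)] (Prod.snd ⁻¹' B : Set (Z × E)) :=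
    le_univSigma _ (measurable_snd hB)
  have := (h.kernel hf).measurable_lintegral
    (hg.indicator hB')
  convert this using 2 with z
  have hslice : @Measurable _ _ (univSigma E) _ fun e => g (z, e) :=
    hg.comp (measurable_univSigma_of_measurable measurable_prodMk_left)
  have hprob : IsProbabilityMeasure ((P z).toMeasure.map f) :=
    Measure.isProbabilityMeasure_map hf.aemeasurable
  have h1 : (fun e => (Prod.snd ⁻¹' B : Set (Z × E)).indicator g (z, e)) =
      B.indicator fun e => g (z, e) := rfl
  rw [h1, lintegral_indicator hB]
  change _ = ∫⁻ e in B, g (z, e) ∂((P z).toMeasure.map f)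
  rw [Measure.restrict_map hf hB, lintegral_map' _ hf.aemeasurable]
  rw [← Measure.restrict_map hf hB]
  exact (aemeasurable_of_univSigma hslice _).restrict

end UnivMeasurableLaw

section Family

variable {X : Type u} {A₁ : Type v} {A₂ : Type w}

theorem hist'_eq_snoc (n : ℕ) (ω : Path X A₁ A₂) :
    Path.hist' n ω = Fin.snoc (Path.hist n ω).1 ((Path.hist n ω).2, (ω n).2) := by
  funext i
  refine Fin.lastCases ?_ (fun j => ?_) i
  · simp [Path.hist', Path.hist]
  · simp [Path.hist', Path.hist]

variable [MeasurableSpace X] [MeasurableSpace A₁] [MeasurableSpace A₂]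

/-- The map which appends the last actions to a history. -/
theorem measurable_snoc_hist (n : ℕ) : Measurable (fun y : Hist X (A₁ × A₂) n × A₁ × A₂ =>
    (Fin.snoc y.1.1 (y.1.2, y.2) : Fin (n + 1) → X × A₁ × A₂)) := by
  refine measurable_pi_iff.2 fun i => ?_
  refine Fin.lastCases ?_ (fun j => ?_) i
  · simp only [Fin.snoc_last]; fun_prop
  · simp only [Fin.snoc_castSucc]; fun_prop

/-- The laws induced by universally measurable families of initial states and policies form a
universally measurable family. -/
theorem measurable_of_isInducedBy [StandardBorelSpace X] [StandardBorelSpace A₁]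
    [StandardBorelSpace A₂] {Z : Type*} [MeasurableSpace Z] (M : Model X A₁ A₂) {x : Z → X}
    (hx : Measurable x) (π₁ : Z → Policy₁ M) (π₂ : Z → Policy₂ M)
    (k₁ : ∀ n, UnivKernel (Z × Hist X A₁ n) A₁)
    (hk₁ : ∀ n z i, (k₁ n).toFun (z, i) = ((π₁ z).kernel n).toFun i)
    (k₂ : ∀ n, UnivKernel (Z × Hist X (A₁ × A₂) n) A₂)
    (hk₂ : ∀ n z h, (k₂ n).toFun (z, h) = ((π₂ z).kernel n).toFun h)
    (P : Z → ProbabilityMeasure (Path X A₁ A₂))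
    (hP : ∀ z, IsInducedBy M (Measure.dirac (x z)) (π₁ z) (π₂ z) (P z).toMeasure) :
    @Measurable Z (ProbabilityMeasure (Path X A₁ A₂)) (univSigma Z) _ P := by
  have h0 : UnivMeasurableLaw P (Path.hist 0) := by
    have h0' : UnivMeasurableLaw P fun ω : Path X A₁ A₂ => (ω 0).1 := by
      intro S hS
      have : (fun z => (P z).toMeasure ((fun ω : Path X A₁ A₂ => (ω 0).1) ⁻¹' S)) =
          fun z => S.indicator 1 (x z) := by
        funext z
        rw [← Measure.dirac_apply' _ hS]
        exact (hP z).init S hS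
      rw [this]
      exact ((measurable_one.indicator hS).comp hx).univSigma
    have := h0'.comp (g := fun x => ((default : Fin 0 → X × A₁ × A₂), x)) (by fun_prop)
    convert this using 1
    funext ω
    exact Prod.ext (Subsingleton.elim _ _) rfl
  -- Measurability passes from h_n to h'_n through the action identity on boxes, which form a
  -- generating π-system; the next step, to h_{n+1}, uses the transition identity.
  have hA : ∀ n, UnivMeasurableLaw P (Path.hist n) → UnivMeasurableLaw P (Path.hist' n) := by
    intro n hn
    have h1 : UnivMeasurableLaw P fun ω : Path X A₁ A₂ =>
        (Path.hist n ω, (ω n).2.1, (ω n).2.2) := by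
      refine .of_isPiSystem ((measurable_hist n).prodMk (by fun_prop))
        (C := image2 (· ×ˢ ·) {s | MeasurableSet s}
          (image2 (· ×ˢ ·) {s | MeasurableSet s} {s | MeasurableSet s})) ?_ ?_ ?_
      · rw [generateFrom_eq_prod MeasurableSpace.generateFrom_measurableSet generateFrom_prod
          isCountablySpanning_measurableSet]
        exact isCountablySpanning_measurableSet.prod isCountablySpanning_measurableSet
      · exact MeasurableSpace.isPiSystem_measurableSet.prod isPiSystem_prod
      · rintro _ ⟨B, hB, _, ⟨C₁, h₁, C₂, h₂, rfl⟩, rfl⟩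
        have hg : @Measurable _ _ (univSigma (Z × Hist X (A₁ × A₂) n)) _
            fun y => (k₁ n).toFun (y.1, y.2.info) C₁ * (k₂ n).toFun y C₂ :=
          measurable_mul_aux (((k₁ n).comap (fun y : Z × Hist X (A₁ × A₂) n => (y.1, y.2.info))
            (measurable_fst.prodMk (measurable_info.comp measurable_snd))).meas C₁ h₁)
            ((k₂ n).meas C₂ h₂)
        have := hn.measurable_setLIntegral (measurable_hist n) hg hB
        convert this using 2 with z
        simp only [hk₁, hk₂]
        exact (hP z).action n B C₁ C₂ hB h₁ h₂
    have h2 := h1.comp (measurable_snoc_hist n)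
    convert h2 using 1
    funext ω
    exact hist'_eq_snoc n ω
  have hB : ∀ n, UnivMeasurableLaw P (Path.hist' n) → UnivMeasurableLaw P (Path.hist (n + 1)) := by
    intro n hn
    refine .of_isPiSystem (measurable_hist (n + 1)) generateFrom_prod.symm isPiSystem_prod ?_
    rintro _ ⟨B, hB, D, hD, rfl⟩
    have hg : @Measurable _ _ (univSigma (Z × (Fin (n + 1) → X × A₁ × A₂))) _
        fun y => M.q (y.2 (Fin.last n)) D :=
      ((Kernel.measurable_coe M.q hD).comp (by fun_prop)).univSigma
    have := hn.measurable_setLIntegral (measurable_hist' n) hg hB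
    convert this using 2 with z
    exact (hP z).trans n B D hB hD
  have hhist : ∀ n, UnivMeasurableLaw P (Path.hist n) := by
    intro n
    induction n with
    | zero => exact h0
    | succ n ih => exact hB n (hA n ih)
  have hid : UnivMeasurableLaw P (id : Path X A₁ A₂ → Path X A₁ A₂) := by
    refine .of_isPiSystem measurable_id generateFrom_measurableCylinders.symm
      isPiSystem_measurableCylinders ?_
    intro S hS
    obtain ⟨I, B, hB, rfl⟩ := (mem_measurableCylinders S).1 hS
    have hg : Measurable (fun (y : Fin (I.sup id + 1) → X × A₁ × A₂) (i : I) =>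
      y ⟨i, Nat.lt_succ_of_le (Finset.le_sup (f := id) i.2)⟩) := by fun_prop
    exact (hA _ (hhist (I.sup id))).comp hg B hB
  refine @Measurable.subtype_mk _ _ (univSigma Z) _ _ _ ?_ _
  refine @Measure.measurable_of_measurable_coe _ _ _ (univSigma Z) _ fun S hS => ?_
  exact hid S hS

end Family

/-! ### Conditional laws depending measurably on the law -/

section CondLaw

variable {Ω : Type*} {E : Type*} {A : Type*} [MeasurableSpace Ω] [MeasurableSpace E]
  [MeasurableSpace A]

/-- The identity kernel from laws to points. -/
def lawKernel (Ω : Type*) [MeasurableSpace Ω] : Kernel (ProbabilityMeasure Ω) Ω :=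
  ⟨ProbabilityMeasure.toMeasure, measurable_toMeasure⟩

instance isMarkovKernel_lawKernel : IsMarkovKernel (lawKernel Ω) := ⟨fun p => p.2⟩

theorem lawKernel_apply (p : ProbabilityMeasure Ω) : lawKernel Ω p = p.toMeasure := rfl

variable [StandardBorelSpace A] [Nonempty A] [MeasurableSpace.CountablyGenerated E]

/-- The conditional law of `g` given `f` under a law `p`, jointly measurable in `p` and the value
of `f`. -/
def condLaw (f : Ω → E) (g : Ω → A) : Kernel (ProbabilityMeasure Ω × E) A :=
  ((lawKernel Ω).map fun ω => (f ω, g ω)).condKernel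

instance isMarkovKernel_condLaw (f : Ω → E) (g : Ω → A) : IsMarkovKernel (condLaw f g) := by
  unfold condLaw
  infer_instance

instance isCondKernel_condLaw (f : Ω → E) (g : Ω → A) :
    ((lawKernel Ω).map fun ω => (f ω, g ω)).IsCondKernel (condLaw f g) := by
  unfold condLaw
  infer_instance

variable {f : Ω → E} {g : Ω → A}

theorem map_prodMk_eq_compProd_condLaw (hf : Measurable f) (hg : Measurable g)
    (p : ProbabilityMeasure Ω) :
    p.toMeasure.map (fun ω => (f ω, g ω)) = p.toMeasure.map f ⊗ₘ (condLaw f g).sectR p := by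
  have hfg : Measurable fun ω => (f ω, g ω) := hf.prodMk hg
  have h := DFunLike.congr_fun
    (Kernel.disintegrate ((lawKernel Ω).map fun ω => (f ω, g ω)) (condLaw f g)) p
  rw [Kernel.compProd_apply_eq_compProd_sectR, Kernel.fst_apply, Kernel.map_apply _ hfg,
    Measure.map_map measurable_fst hfg] at h
  exact h.symm

/-- Disintegrations are almost everywhere unique. -/
theorem ae_eq_condLaw (hf : Measurable f) (hg : Measurable g) (p : ProbabilityMeasure Ω)
    {η : Kernel E A} [IsMarkovKernel η]
    (h : p.toMeasure.map (fun ω => (f ω, g ω)) = p.toMeasure.map f ⊗ₘ η) :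
    ∀ᵐ e ∂(p.toMeasure.map f), condLaw f g (p, e) = η e := by
  have := Measure.isProbabilityMeasure_map (μ := p.toMeasure) hf.aemeasurable
  exact Kernel.ae_eq_of_compProd_eq ((map_prodMk_eq_compProd_condLaw hf hg p).symm.trans h)

end CondLaw

section Kernels

variable {Ω : Type*} {E : Type*} {A : Type*} [MeasurableSpace Ω] [MeasurableSpace E]
  [MeasurableSpace A]

/-- A passage between the form on rectangles used for induced laws and the composition-product used
for conditional laws. -/
theorem map_prodMk_eq_compProd_iff {f : Ω → E} {g : Ω → A} (hf : Measurable f) (hg : Measurable g)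
    (P : Measure Ω) [IsProbabilityMeasure P] (η : Kernel E A) [IsMarkovKernel η] :
    P.map (fun ω => (f ω, g ω)) = P.map f ⊗ₘ η ↔
      ∀ B C, MeasurableSet B → MeasurableSet C →
        P {ω | f ω ∈ B ∧ g ω ∈ C} = ∫⁻ ω in {ω | f ω ∈ B}, η (f ω) C ∂P := by
  have hfg : Measurable fun ω => (f ω, g ω) := hf.prodMk hg
  have h1 : IsProbabilityMeasure (P.map fun ω => (f ω, g ω)) :=
    Measure.isProbabilityMeasure_map hfg.aemeasurable
  have h2 : IsProbabilityMeasure (P.map f) := Measure.isProbabilityMeasure_map hf.aemeasurable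
  have key : ∀ B C, MeasurableSet B → MeasurableSet C →
      (P.map f ⊗ₘ η) (B ×ˢ C) = ∫⁻ ω in {ω | f ω ∈ B}, η (f ω) C ∂P := by
    intro B C hB hC
    rw [Measure.compProd_apply_prod hB hC, Measure.restrict_map hf hB,
      lintegral_map (Kernel.measurable_coe _ hC) hf]
    rfl
  rw [Measure.ext_prod_iff]
  refine forall₂_congr fun B C => forall₂_congr fun hB hC => ?_
  rw [key B C hB hC, Measure.map_apply hfg (hB.prod hC)]
  rfl

/-- A Markov kernel as a map into the space of probability measures. -/
def kernelLaw (κ : Kernel E A) [IsMarkovKernel κ] (e : E) : ProbabilityMeasure A :=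
  ⟨κ e, inferInstance⟩

theorem measurable_kernelLaw (κ : Kernel E A) [IsMarkovKernel κ] : Measurable (kernelLaw κ) :=
  κ.measurable.subtype_mk

/-- The laws on `A` form a standard Borel space, whose diagonal is measurable. -/
theorem measurableSet_kernel_eq [StandardBorelSpace A] (κ η : Kernel E A) [IsMarkovKernel κ]
    [IsMarkovKernel η] : MeasurableSet {e | κ e = η e} := by
  convert measurableSet_eq_fun (measurable_kernelLaw κ) (measurable_kernelLaw η) using 1
  ext e
  exact Subtype.mk_eq_mk.symm

/-- The points at which a kernel charges only the section of an analytic set form an analytic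
set. -/
theorem isAnalytic_setOf_kernel_section_eq_one {X : Type*} [MeasurableSpace X]
    [StandardBorelSpace X] [StandardBorelSpace A] [StandardBorelSpace E] {G : Set (X × A)}
    (hG : IsAnalytic G) (κ : Kernel E A) [IsMarkovKernel κ] {x : E → X} (hx : Measurable x) :
    IsAnalytic {e | κ e {a | (x e, a) ∈ G} = 1} := by
  -- Attaching the point `x e` to the kernel turns the varying section into the fixed analytic set
  -- `G`.
  let Q : Kernel E (X × A) := Kernel.deterministic x hx ×ₖ κ
  have hQ : ∀ e, Q e = (κ e).map (Prod.mk (x e)) := fun e => by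
    rw [Kernel.prod_apply, Kernel.deterministic_apply, Measure.dirac_prod]
  convert hG.setOf_measure_eq_one.preimage (measurable_kernelLaw Q) using 1
  ext e
  have : (κ e).map (Prod.mk (x e)) G = κ e {a | (x e, a) ∈ G} := by
    have hp : IsProbabilityMeasure ((κ e).map (Prod.mk (x e))) :=
      Measure.isProbabilityMeasure_map (by fun_prop)
    exact Measure.map_apply₀ (by fun_prop)
      (hG.measurableSet_univSigma ⟨(κ e).map (Prod.mk (x e)), hp⟩)
  change _ ↔ Q e G = 1
  rw [hQ, this]
  rfl

end Kernels

/-! ### Laws consistent with the behaviour of player 1 -/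

section Consistent

variable {X : Type u} {A₁ : Type v} {A₂ : Type w}
  [MeasurableSpace X] [MeasurableSpace A₁] [MeasurableSpace A₂]

theorem measurable_pathInfo (n : ℕ) : Measurable (Path.info n : Path X A₁ A₂ → Hist X A₁ n) :=
  measurable_info.comp (measurable_hist n)

variable [StandardBorelSpace X] [StandardBorelSpace A₁] [StandardBorelSpace A₂]

/-- The conditional law of the action of player 1 given his information. -/
def condAct₁ (X : Type u) (A₁ : Type v) (A₂ : Type w)
    [MeasurableSpace X] [MeasurableSpace A₁] [MeasurableSpace A₂]
    [StandardBorelSpace X] [StandardBorelSpace A₁] [Nonempty A₁] (n : ℕ) :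
    Kernel (ProbabilityMeasure (Path X A₁ A₂) × Hist X A₁ n) A₁ :=
  condLaw (Path.info n) fun ω => (ω n).2.1

/-- The conditional law of the action of player 2 given the history. -/
def condAct₂ (X : Type u) (A₁ : Type v) (A₂ : Type w)
    [MeasurableSpace X] [MeasurableSpace A₁] [MeasurableSpace A₂]
    [StandardBorelSpace X] [StandardBorelSpace A₁] [StandardBorelSpace A₂] [Nonempty A₂] (n : ℕ) :
    Kernel (ProbabilityMeasure (Path X A₁ A₂) × Hist X (A₁ × A₂) n) A₂ :=
  condLaw (Path.hist n) fun ω => (ω n).2.2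

variable [Nonempty A₁] [Nonempty A₂]

instance (n : ℕ) : IsMarkovKernel (condAct₁ X A₁ A₂ n) := isMarkovKernel_condLaw _ _

instance (n : ℕ) : IsMarkovKernel (condAct₂ X A₁ A₂ n) := isMarkovKernel_condLaw _ _

/-- The conditional law of the actions given the history, for a pair of laws `(m, ρ)`: player 1
acts according to `m` and player 2 according to `ρ`. -/
def condActs (X : Type u) (A₁ : Type v) (A₂ : Type w)
    [MeasurableSpace X] [MeasurableSpace A₁] [MeasurableSpace A₂]
    [StandardBorelSpace X] [StandardBorelSpace A₁] [StandardBorelSpace A₂]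
    [Nonempty A₁] [Nonempty A₂] (n : ℕ) :
    Kernel ((ProbabilityMeasure (Path X A₁ A₂) × ProbabilityMeasure (Path X A₁ A₂)) ×
      Hist X (A₁ × A₂) n) (A₁ × A₂) :=
  (condAct₁ X A₁ A₂ n).comap (fun y => (y.1.1, y.2.info))
      (measurable_fst.fst.prodMk (measurable_info.comp measurable_snd)) ×ₖ
    (condAct₂ X A₁ A₂ n).comap (fun y => (y.1.2, y.2)) (by fun_prop)

instance (n : ℕ) : IsMarkovKernel (condActs X A₁ A₂ n) := by
  unfold condActs
  infer_instance

/-- The law `ρ` is generated by the behaviour of player 1 under the law `m`, by the transition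
kernel of the model, and by some admissible behaviour of player 2. -/
structure Consistent (M : Model X A₁ A₂) (m ρ : ProbabilityMeasure (Path X A₁ A₂)) : Prop where
  init : ρ.toMeasure.map (fun ω => (ω 0).1) = m.toMeasure.map fun ω => (ω 0).1
  action : ∀ n, ρ.toMeasure.map (fun ω => (Path.hist n ω, (ω n).2)) =
    ρ.toMeasure.map (Path.hist n) ⊗ₘ (condActs X A₁ A₂ n).sectR (m, ρ)
  trans : ∀ n, ρ.toMeasure.map (fun ω => (Path.hist' n ω, (ω (n + 1)).1)) =
    ρ.toMeasure.map (Path.hist' n) ⊗ₘ M.q.comap (fun y => y (Fin.last n)) (by fun_prop)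
  adm : ∀ n, ρ.toMeasure.map (fun ω => ((ω n).1, (ω n).2.2)) {z | z.2 ∈ M.adm₂ z.1} = 1
  absCont : ∀ n, ρ.toMeasure.map (Path.info n) ≪ m.toMeasure.map (Path.info n)

/-- There are countably many conditions. Those on initial law, actions and transitions are
equalities of kernels in the pair (m, ρ), and absolute continuity of kernels is also a Borel
condition. Only admissibility is merely analytic. -/
theorem isAnalytic_consistent (M : Model X A₁ A₂) :
    IsAnalytic {y : ProbabilityMeasure (Path X A₁ A₂) × ProbabilityMeasure (Path X A₁ A₂) |
      Consistent M y.1 y.2} := by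
  have hMk := M.markov
  let Ω := Path X A₁ A₂
  let κ₁ : Kernel (ProbabilityMeasure Ω × ProbabilityMeasure Ω) Ω :=
    (lawKernel Ω).comap Prod.fst measurable_fst
  let κ₂ : Kernel (ProbabilityMeasure Ω × ProbabilityMeasure Ω) Ω :=
    (lawKernel Ω).comap Prod.snd measurable_snd
  have e0 : Measurable fun ω : Ω => (ω 0).1 := by fun_prop
  have eA : ∀ n, Measurable fun ω : Ω => (Path.hist n ω, (ω n).2) := fun n =>
    (measurable_hist n).prodMk (by fun_prop)
  have eT : ∀ n, Measurable fun ω : Ω => (Path.hist' n ω, (ω (n + 1)).1) := fun n =>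
    (measurable_hist' n).prodMk (by fun_prop)
  have eD : ∀ n, Measurable fun ω : Ω => ((ω n).1, (ω n).2.2) := fun n => by fun_prop
  have h0 : MeasurableSet {y | κ₂.map (fun ω => (ω 0).1) y = κ₁.map (fun ω => (ω 0).1) y} := by
    have := Kernel.IsMarkovKernel.map κ₁ e0
    have := Kernel.IsMarkovKernel.map κ₂ e0
    exact measurableSet_kernel_eq _ _
  have hA : ∀ n, MeasurableSet {y | κ₂.map (fun ω => (Path.hist n ω, (ω n).2)) y =
      (κ₂.map (Path.hist n) ⊗ₖ condActs X A₁ A₂ n) y} := fun n => by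
    have := Kernel.IsMarkovKernel.map κ₂ (eA n)
    have := Kernel.IsMarkovKernel.map κ₂ (measurable_hist n)
    exact measurableSet_kernel_eq _ _
  have hT : ∀ n, MeasurableSet {y | κ₂.map (fun ω => (Path.hist' n ω, (ω (n + 1)).1)) y =
      (κ₂.map (Path.hist' n) ⊗ₖ M.q.comap (fun y => y.2 (Fin.last n)) (by fun_prop)) y} :=
    fun n => by
    have := Kernel.IsMarkovKernel.map κ₂ (eT n)
    have := Kernel.IsMarkovKernel.map κ₂ (measurable_hist' n)
    exact measurableSet_kernel_eq _ _
  have hD : ∀ n, IsAnalytic {y : ProbabilityMeasure Ω × ProbabilityMeasure Ω |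
      y.2.toMeasure.map (fun ω => ((ω n).1, (ω n).2.2)) {z | z.2 ∈ M.adm₂ z.1} = 1} := fun n =>
    M.adm₂_analytic.setOf_measure_eq_one.preimage
      ((measurable_pushforward (eD n)).comp measurable_snd)
  have hC : ∀ n, MeasurableSet {y | κ₂.map (Path.info n) y ≪ κ₁.map (Path.info n) y} := fun n =>
    Kernel.measurableSet_absolutelyContinuous _ _
  have key := (IsAnalytic.of_measurableSet h0).inter (IsAnalytic.iInter fun n =>
    ((IsAnalytic.of_measurableSet (hA n)).inter (.of_measurableSet (hT n))).inter
      ((hD n).inter (.of_measurableSet (hC n))))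
  convert key using 1
  ext ⟨m, ρ⟩
  simp only [mem_inter_iff, mem_iInter, mem_ofPred_eq, Kernel.compProd_apply_eq_compProd_sectR,
    Kernel.map_apply _ e0, Kernel.map_apply _ (eA _), Kernel.map_apply _ (eT _),
    Kernel.map_apply _ (measurable_hist _), Kernel.map_apply _ (measurable_hist' _),
    Kernel.map_apply _ (measurable_pathInfo _), κ₁, κ₂, Kernel.comap_apply, lawKernel_apply]
  constructor
  · rintro ⟨h1, h2, h3, h4, h5⟩
    exact ⟨h1, fun n => ⟨⟨h2 n, h3 n⟩, h4 n, h5 n⟩⟩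
  · rintro ⟨h1, h2⟩
    exact ⟨h1, fun n => (h2 n).1.1, fun n => (h2 n).1.2, fun n => (h2 n).2.1, fun n => (h2 n).2.2⟩

end Consistent

/-! ### Realizing consistent laws by policies of player 2 -/

section Response

variable {X : Type u} {A₁ : Type v} {A₂ : Type w}

/-- The initial state of a history. -/
def Hist.initState {B : Type v} : {n : ℕ} → Hist X B n → X
  | 0, h => h.2
  | _ + 1, h => (h.1 0).1

theorem initState_hist (n : ℕ) (ω : Path X A₁ A₂) : (Path.hist n ω).initState = (ω 0).1 := by
  cases n <;> rfl

/-- Splitting off the first stage of a history. -/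
def Hist.uncons {B : Type v} {n : ℕ} (h : Hist X B (n + 1)) : (X × B) × Hist X B n :=
  (h.1 0, (Fin.tail h.1, h.2))

theorem uncons_cons {B : Type v} {n : ℕ} (b : X × B) (h : Hist X B n) :
    (Hist.cons b h).uncons = (b, h) := by
  simp [Hist.uncons, Hist.cons]

variable [MeasurableSpace X] [MeasurableSpace A₁] [MeasurableSpace A₂]

theorem measurable_initState {B : Type v} [MeasurableSpace B] {n : ℕ} :
    Measurable (Hist.initState : Hist X B n → X) := by
  cases n
  · exact measurable_snd
  · change Measurable fun h : Hist X B (_ + 1) => (h.1 0).1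
    fun_prop

theorem measurable_uncons {B : Type v} [MeasurableSpace B] {n : ℕ} :
    Measurable (Hist.uncons : Hist X B (n + 1) → (X × B) × Hist X B n) := by
  unfold Hist.uncons Fin.tail
  fun_prop

theorem measurable_cons_prod {B : Type v} [MeasurableSpace B] {n : ℕ} :
    Measurable fun y : (X × B) × Hist X B n => Hist.cons y.1 y.2 := by
  unfold Hist.cons
  refine Measurable.prodMk (measurable_pi_iff.2 fun i => ?_) (by fun_prop)
  refine Fin.cases ?_ (fun j => ?_) i
  · simp only [Fin.cons_zero]
    fun_prop
  · simp only [Fin.cons_succ]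
    fun_prop

/-- Player 2 has a policy. -/
theorem nonempty_policy₂ [StandardBorelSpace X] [Nonempty A₂] (M : Model X A₁ A₂) : Nonempty (Policy₂ M) := by
  obtain ⟨s, hs, hsM⟩ := M.adm₂_analytic.exists_section
  have hs' : ∀ x, s x ∈ M.adm₂ x := fun x => by
    obtain ⟨a, ha⟩ := M.adm₂_nonempty x
    exact hsM x a ha
  refine ⟨⟨fun n => ⟨fun h => Measure.dirac (s h.2), fun _ => inferInstance, fun B hB => ?_⟩,
    fun n h => ?_⟩⟩
  · exact (Measure.measurable_coe hB).comp (Measure.measurable_dirac.comp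
      (hs.comp (measurable_univSigma_of_measurable measurable_snd)))
  · refine le_antisymm prob_le_one ?_
    exact (Measure.le_dirac_apply).trans' (by simp [hs' h.2])

variable [StandardBorelSpace X] [StandardBorelSpace A₁]

variable {M : Model X A₁ A₂} {p₀ : Measure X} {π₁ : Policy₁ M}
  {π₂ : Policy₂ M} {ρ : ProbabilityMeasure (Path X A₁ A₂)}

/-- Under an induced law, the conditional law of the action of player 1 is given by his policy. -/
theorem IsInducedBy.ae_condAct₁ [Nonempty A₁] (h : IsInducedBy M p₀ π₁ π₂ ρ.toMeasure) (n : ℕ) :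
    ∀ᵐ i ∂(ρ.toMeasure.map (Path.info n)),
      condAct₁ X A₁ A₂ n (ρ, i) = (π₁.kernel n).toFun i := by
  have hi := measurable_pathInfo (X := X) (A₁ := A₁) (A₂ := A₂) n
  have := Measure.isProbabilityMeasure_map (μ := ρ.toMeasure) hi.aemeasurable
  obtain ⟨η, hη, e⟩ := (π₁.kernel n).exists_version (ρ.toMeasure.map (Path.info n))
  have ha : Measurable fun ω : Path X A₁ A₂ => (ω n).2.1 := by fun_prop
  -- By uniqueness of conditional laws it suffices that a Borel version of the policy's kernel
  -- disintegrates the law.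
  have := ae_eq_condLaw hi ha ρ (η := η) ((map_prodMk_eq_compProd_iff hi ha _ η).2
    fun B C hB hC => ?_)
  · filter_upwards [this, e] with i h1 h2
    exact h1.trans h2
  -- Taking all of `A₂` integrates out player 2, and only events about i_n are needed.
  · have := h.action n (Hist.info ⁻¹' B) C univ (measurable_info hB) hC .univ
    simp only [mem_univ, and_true] at this
    refine this.trans (lintegral_congr_ae (ae_restrict_of_ae ?_))
    filter_upwards [ae_of_ae_map hi.aemeasurable e] with ω hω
    have := (π₂.kernel n).prob (Path.hist n ω)
    rw [hω, measure_univ, mul_one]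

variable [StandardBorelSpace A₂] [Nonempty A₂]

/-- Under an induced law, the conditional law of the action of player 2 is given by his policy. -/
theorem IsInducedBy.ae_condAct₂ (h : IsInducedBy M p₀ π₁ π₂ ρ.toMeasure) (n : ℕ) :
    ∀ᵐ i ∂(ρ.toMeasure.map (Path.hist n)),
      condAct₂ X A₁ A₂ n (ρ, i) = (π₂.kernel n).toFun i := by
  have hi := measurable_hist (X := X) (A₁ := A₁) (A₂ := A₂) n
  have := Measure.isProbabilityMeasure_map (μ := ρ.toMeasure) hi.aemeasurable
  obtain ⟨η, hη, e⟩ := (π₂.kernel n).exists_version (ρ.toMeasure.map (Path.hist n))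
  have ha : Measurable fun ω : Path X A₁ A₂ => (ω n).2.2 := by fun_prop
  have := ae_eq_condLaw hi ha ρ (η := η) ((map_prodMk_eq_compProd_iff hi ha _ η).2
    fun B C hB hC => ?_)
  · filter_upwards [this, e] with i h1 h2
    exact h1.trans h2
  · have := h.action n B univ C hB .univ hC
    simp only [mem_univ, true_and] at this
    refine this.trans (lintegral_congr_ae (ae_restrict_of_ae ?_))
    filter_upwards [ae_of_ae_map hi.aemeasurable e] with ω hω
    have := (π₁.kernel n).prob (Path.info n ω)
    rw [hω, measure_univ, one_mul]

/-- The behaviour of player 2 after the first stage which realizes the laws `Ψ`, where `Ψ` depends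
on the first stage of player 1 and on the next state; the policy `π₂` is used where this behaviour
is not admissible. -/
def responseKernel (π₂ : Policy₂ M) (Ψ : (X × A₁) × X → ProbabilityMeasure (Path X A₁ A₂))
    (hΨ : @Measurable _ _ (univSigma ((X × A₁) × X)) _ Ψ) (n : ℕ) :
    UnivKernel ((X × A₁ × A₂) × Hist X (A₁ × A₂) n) A₂ := by
  classical
  exact
  { toFun := fun y =>
      if condAct₂ X A₁ A₂ n (Ψ ((y.1.1, y.1.2.1), y.2.initState), y.2) (M.adm₂ y.2.2) = 1 then
        condAct₂ X A₁ A₂ n (Ψ ((y.1.1, y.1.2.1), y.2.initState), y.2)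
      else (π₂.kernel n).toFun y.2
    prob := fun y => by
      split_ifs
      · infer_instance
      · exact (π₂.kernel n).prob _
    meas := fun B hB => by
      have hu : @Measurable _ _ (univSigma ((X × A₁ × A₂) × Hist X (A₁ × A₂) n)) _
          fun y => (Ψ ((y.1.1, y.1.2.1), y.2.initState), y.2) := by
        refine Measurable.prodMk ?_ (Measurable.univSigma measurable_snd)
        refine hΨ.comp (measurable_univSigma_of_measurable ?_)
        exact Measurable.prodMk (by fun_prop) (measurable_initState.comp measurable_snd)
      -- Admissibility is an analytic condition on the pair of law and history, so it stays
      -- universally measurable after substituting `Ψ`.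
      have hS := (isAnalytic_setOf_kernel_section_eq_one M.adm₂_analytic (condAct₂ X A₁ A₂ n)
        (measurable_snd.comp measurable_snd)).measurableSet_univSigma
      simp only [apply_ite (fun μ : Measure A₂ => μ B)]
      refine Measurable.ite (measurable_univSigma_univSigma hu hS) ?_ ?_
      · exact (Kernel.measurable_coe (condAct₂ X A₁ A₂ n) hB).comp hu
      · exact ((π₂.kernel n).meas B hB).comp (measurable_univSigma_of_measurable measurable_snd) }

theorem responseKernel_feasible (π₂ : Policy₂ M)
    (Ψ : (X × A₁) × X → ProbabilityMeasure (Path X A₁ A₂))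
    (hΨ : @Measurable _ _ (univSigma ((X × A₁) × X)) _ Ψ) (n : ℕ)
    (y : (X × A₁ × A₂) × Hist X (A₁ × A₂) n) :
    (responseKernel π₂ Ψ hΨ n).toFun y (M.adm₂ y.2.2) = 1 := by
  simp only [responseKernel]
  split_ifs with h
  · exact h
  · exact π₂.feasible n y.2

/-- The policy of player 2 which realizes the laws `Ψ` after the first stage. -/
def responsePolicy (π₂ : Policy₂ M) (Ψ : (X × A₁) × X → ProbabilityMeasure (Path X A₁ A₂))
    (hΨ : @Measurable _ _ (univSigma ((X × A₁) × X)) _ Ψ) : Policy₂ M where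
  kernel
    -- The behaviour at the first stage enters no shifted policy.
    | 0 => π₂.kernel 0
    | n + 1 => (responseKernel π₂ Ψ hΨ n).comap Hist.uncons measurable_uncons
  feasible
    | 0, h => π₂.feasible 0 h
    | n + 1, h => responseKernel_feasible π₂ Ψ hΨ n h.uncons

theorem responsePolicy_shift_kernel (π₂ : Policy₂ M)
    (Ψ : (X × A₁) × X → ProbabilityMeasure (Path X A₁ A₂))
    (hΨ : @Measurable _ _ (univSigma ((X × A₁) × X)) _ Ψ) (b : X × A₁ × A₂) (n : ℕ)
    (h : Hist X (A₁ × A₂) n)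
    (hb : condAct₂ X A₁ A₂ n (Ψ ((b.1, b.2.1), h.initState), h) (M.adm₂ h.2) = 1) :
    (((responsePolicy π₂ Ψ hΨ).shift b).kernel n).toFun h =
      condAct₂ X A₁ A₂ n (Ψ ((b.1, b.2.1), h.initState), h) := by
  change (responseKernel π₂ Ψ hΨ n).toFun (Hist.cons b h).uncons = _
  rw [uncons_cons]
  simp only [responseKernel]
  exact if_pos hb

variable [Nonempty A₁]

theorem condActs_sectR_prod (n : ℕ) (m ρ : ProbabilityMeasure (Path X A₁ A₂))
    (h : Hist X (A₁ × A₂) n) (C₁ : Set A₁) (C₂ : Set A₂) :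
    (condActs X A₁ A₂ n).sectR (m, ρ) h (C₁ ×ˢ C₂) =
      condAct₁ X A₁ A₂ n (m, h.info) C₁ * condAct₂ X A₁ A₂ n (ρ, h) C₂ := by
  rw [Kernel.sectR_apply, condActs, Kernel.prod_apply, Measure.prod_prod]
  rfl

/-- The laws induced by a policy of player 1 and two policies of player 2 are consistent. -/
theorem IsInducedBy.consistent {π₂' : Policy₂ M} {m : ProbabilityMeasure (Path X A₁ A₂)}
    (h : IsInducedBy M p₀ π₁ π₂ ρ.toMeasure) (hm : IsInducedBy M p₀ π₁ π₂' m.toMeasure)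
    (hac : ∀ n, ρ.toMeasure.map (Path.info n) ≪ m.toMeasure.map (Path.info n)) :
    Consistent M m ρ := by
  have hMk := M.markov
  refine ⟨?_, fun n => ?_, fun n => ?_, fun n => ?_, hac⟩
  · ext D hD
    rw [Measure.map_apply (by fun_prop) hD, Measure.map_apply (by fun_prop) hD]
    exact (h.init D hD).trans (hm.init D hD).symm
  · have hh := measurable_hist (X := X) (A₁ := A₁) (A₂ := A₂) n
    have hf : Measurable fun ω : Path X A₁ A₂ => (Path.hist n ω, (ω n).2) :=
      hh.prodMk (by fun_prop)
    have hp := Measure.isProbabilityMeasure_map (μ := ρ.toMeasure) hf.aemeasurable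
    have hp' := Measure.isProbabilityMeasure_map (μ := ρ.toMeasure) hh.aemeasurable
    refine Measure.ext_prod₃ fun {B C₁ C₂} hB h₁ h₂ => ?_
    rw [Measure.map_apply hf (hB.prod (h₁.prod h₂)),
      Measure.compProd_apply_prod hB (h₁.prod h₂), Measure.restrict_map hh hB,
      lintegral_map (Kernel.measurable_coe _ (h₁.prod h₂)) hh]
    refine (h.action n B C₁ C₂ hB h₁ h₂).trans (lintegral_congr_ae (ae_restrict_of_ae ?_))
    -- Player 1's conditional law under `m` is his policy `m`-almost surely; absolute continuity on
    -- I_n makes this hold `ρ`-almost surely.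
    have e1 := ae_of_ae_map (measurable_pathInfo n).aemeasurable
      ((hac n).ae_le (hm.ae_condAct₁ n))
    filter_upwards [e1, ae_of_ae_map hh.aemeasurable (h.ae_condAct₂ n)] with ω h1 h2
    rw [condActs_sectR_prod, ← h1, h2]
    rfl
  · exact (map_prodMk_eq_compProd_iff (measurable_hist' n) (by fun_prop) _ _).2 (h.trans n)
  · have hf : Measurable fun ω : Path X A₁ A₂ => ((ω n).1, (ω n).2.2) := by fun_prop
    have hp := Measure.isProbabilityMeasure_map (μ := ρ.toMeasure) hf.aemeasurable
    refine le_antisymm prob_le_one ?_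
    set G := {z : X × A₂ | z.2 ∈ M.adm₂ z.1}
    -- The graph `G` is only analytic, so the computation runs on a measurable hull.
    set G' := toMeasurable (ρ.toMeasure.map fun ω => ((ω n).1, (ω n).2.2)) G with hG'
    have hG'm : MeasurableSet G' := measurableSet_toMeasurable _ _
    have hh := measurable_hist (X := X) (A₁ := A₁) (A₂ := A₂) n
    have ha : Measurable fun ω : Path X A₁ A₂ => (ω n).2.2 := by fun_prop
    have hp' := Measure.isProbabilityMeasure_map (μ := ρ.toMeasure) hh.aemeasurable
    have hT : Measurable fun y : Hist X (A₁ × A₂) n × A₂ => (y.1.2, y.2) := by fun_prop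
    rw [← measure_toMeasurable, ← hG', Measure.map_apply hf hG'm]
    have h1 : ρ.toMeasure ((fun ω => ((ω n).1, (ω n).2.2)) ⁻¹' G') =
        (ρ.toMeasure.map fun ω => (Path.hist n ω, (ω n).2.2))
          ((fun y : Hist X (A₁ × A₂) n × A₂ => (y.1.2, y.2)) ⁻¹' G') := by
      rw [Measure.map_apply (hh.prodMk ha) (hT hG'm)]
      rfl
    rw [h1, map_prodMk_eq_compProd_condLaw hh ha, Measure.compProd_apply (hT hG'm)]
    have h2 : ∀ᵐ i ∂(ρ.toMeasure.map (Path.hist n)),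
        (1 : ℝ≥0∞) ≤ (condLaw (Path.hist n) fun ω => (ω n).2.2).sectR ρ i
          (Prod.mk i ⁻¹' ((fun y : Hist X (A₁ × A₂) n × A₂ => (y.1.2, y.2)) ⁻¹' G')) := by
      filter_upwards [h.ae_condAct₂ n] with i hi
      rw [Kernel.sectR_apply]
      change 1 ≤ condAct₂ X A₁ A₂ n (ρ, i) _
      rw [hi, ← π₂.feasible n i]
      exact measure_mono fun a ha => subset_toMeasurable _ _ ha
    calc (1 : ℝ≥0∞) = ∫⁻ _, 1 ∂(ρ.toMeasure.map (Path.hist n)) := by simp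
      _ ≤ _ := lintegral_mono_ae h2

/-- The response policy realizes every law which is consistent with the behaviour of player 1. -/
theorem isInducedBy_responsePolicy (π₂ : Policy₂ M)
    (Ψ : (X × A₁) × X → ProbabilityMeasure (Path X A₁ A₂))
    (hΨ : @Measurable _ _ (univSigma ((X × A₁) × X)) _ Ψ) (b : X × A₁ × A₂) (x : X)
    {π₁ : Policy₁ M} {π₂' : Policy₂ M} {m : ProbabilityMeasure (Path X A₁ A₂)}
    (hm : IsInducedBy M (Measure.dirac x) π₁ π₂' m.toMeasure)
    (hc : Consistent M m (Ψ ((b.1, b.2.1), x))) :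
    IsInducedBy M (Measure.dirac x) π₁ ((responsePolicy π₂ Ψ hΨ).shift b)
      (Ψ ((b.1, b.2.1), x)).toMeasure := by
  have hMk := M.markov
  set ρ := Ψ ((b.1, b.2.1), x) with hρ
  have hinit : ∀ D : Set X, MeasurableSet D →
      ρ.toMeasure {ω | (ω 0).1 ∈ D} = Measure.dirac x D := by
    intro D hD
    rw [← hm.init D hD]
    have := congrArg (fun μ => μ D) hc.init
    simp only [Measure.map_apply (show Measurable fun ω : Path X A₁ A₂ => (ω 0).1 by fun_prop) hD]
      at this
    exact this
  refine ⟨hinit, fun n B C₁ C₂ hB h₁ h₂ => ?_, fun n => (map_prodMk_eq_compProd_iff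
    (measurable_hist' n) (by fun_prop) _ _).1 (hc.trans n)⟩
  have hh := measurable_hist (X := X) (A₁ := A₁) (A₂ := A₂) n
  have ha : Measurable fun ω : Path X A₁ A₂ => (ω n).2.2 := by fun_prop
  have hhp := Measure.isProbabilityMeasure_map (μ := ρ.toMeasure) hh.aemeasurable
  refine action_of_compProd π₁ _ n ρ.toMeasure (Path.hist n) hh id measurable_id (fun _ => rfl)
    ((condActs X A₁ A₂ n).sectR (m, ρ)) (hc.action n) ?_ B C₁ C₂ hB h₁ h₂
  rw [Measure.map_id]
  have e1 : ∀ᵐ h ∂(ρ.toMeasure.map (Path.hist n)),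
      condAct₁ X A₁ A₂ n (m, h.info) = (π₁.kernel n).toFun h.info := by
    have := (hc.absCont n).ae_le (hm.ae_condAct₁ n)
    have hfac : (Path.info n : Path X A₁ A₂ → _) = Hist.info ∘ Path.hist n := rfl
    rw [hfac, ← Measure.map_map measurable_info hh] at this
    exact ae_of_ae_map measurable_info.aemeasurable this
  -- Along almost every history the response kernel thus reads the same law `ρ` from `Ψ`.
  have e2 : ∀ᵐ h ∂(ρ.toMeasure.map (Path.hist n)), h.initState = x := by
    refine (ae_map_iff hh.aemeasurable (p := fun h => h.initState = x)
      (measurable_initState (measurableSet_singleton x))).2 ?_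
    simp only [initState_hist]
    have hx := hinit {x} (measurableSet_singleton x)
    rw [Measure.dirac_apply_of_mem (mem_singleton x)] at hx
    have hmx : MeasurableSet {ω : Path X A₁ A₂ | (ω 0).1 ∈ ({x} : Set X)} :=
      (show Measurable fun ω : Path X A₁ A₂ => (ω 0).1 by fun_prop) (measurableSet_singleton x)
    exact (mem_ae_iff_prob_eq_one hmx).2 hx
  -- Consequently the fallback policy is almost surely not used.
  have e3 : ∀ᵐ h ∂(ρ.toMeasure.map (Path.hist n)),
      condAct₂ X A₁ A₂ n (ρ, h) (M.adm₂ h.2) = 1 := by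
    have hf : Measurable fun ω : Path X A₁ A₂ => ((ω n).1, (ω n).2.2) := by fun_prop
    have hp := Measure.isProbabilityMeasure_map (μ := ρ.toMeasure) hf.aemeasurable
    have hG : NullMeasurableSet {z : X × A₂ | z.2 ∈ M.adm₂ z.1}
        (ρ.toMeasure.map fun ω => ((ω n).1, (ω n).2.2)) :=
      M.adm₂_analytic.measurableSet_univSigma ⟨_, hp⟩
    have hnull := (prob_compl_eq_zero_iff₀ hG).2 (hc.adm n)
    have h1 : ∀ᵐ z ∂(ρ.toMeasure.map fun ω => ((ω n).1, (ω n).2.2)), z.2 ∈ M.adm₂ z.1 :=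
      hnull
    have hfac : (fun ω : Path X A₁ A₂ => ((ω n).1, (ω n).2.2)) =
        (fun y : Hist X (A₁ × A₂) n × A₂ => (y.1.2, y.2)) ∘
          fun ω => (Path.hist n ω, (ω n).2.2) := rfl
    rw [hfac, ← Measure.map_map (by fun_prop) (hh.prodMk ha)] at h1
    have h2 := ae_of_ae_map (by fun_prop) h1
    rw [map_prodMk_eq_compProd_condLaw hh ha] at h2
    filter_upwards [Measure.ae_ae_of_ae_compProd h2] with h h3
    refine le_antisymm prob_le_one ?_
    have h4 : condAct₂ X A₁ A₂ n (ρ, h) (M.adm₂ h.2)ᶜ = 0 := h3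
    -- Sections of the admissible graph are not assumed Borel, hence subadditivity instead of the
    -- complement formula.
    calc (1 : ℝ≥0∞) = condAct₂ X A₁ A₂ n (ρ, h) univ := measure_univ.symm
      _ ≤ condAct₂ X A₁ A₂ n (ρ, h) (M.adm₂ h.2) + condAct₂ X A₁ A₂ n (ρ, h) (M.adm₂ h.2)ᶜ := by
        rw [← union_compl_self (M.adm₂ h.2)]
        exact measure_union_le _ _
      _ = _ := by rw [h4, add_zero]
  filter_upwards [e1, e2, e3] with h h1 h2 h3 D₁ D₂
  rw [condActs_sectR_prod, h1, responsePolicy_shift_kernel π₂ Ψ hΨ b n h]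
  · rw [h2, ← hρ]
  · rw [h2, ← hρ]
    exact h3

end Response

/-! ### The near-optimal response -/

/-- Against a fixed policy of player 1, player 2 has a policy whose shifted versions are all nearly
optimal responses to the shifted policies of player 1. -/
theorem exists_nearOptimal_response {X : Type u} {A₁ : Type v} {A₂ : Type w}
    [MeasurableSpace X] [StandardBorelSpace X]
    [MeasurableSpace A₁] [StandardBorelSpace A₁]
    [MeasurableSpace A₂] [StandardBorelSpace A₂]
    (M : Model X A₁ A₂) (J : Policy₁ M → Policy₂ M → X → EReal)
    (hAbs : AbsContAssumption M) (hJ : CriterionAssumption M J)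
    (πbar₁ : Policy₁ M) (ε : ℝ) (hε : 0 < ε) :
    ∃ π₂ : Policy₂ M, ∀ (x₀ : X) (a₁ : A₁) (a₂ : A₂) (x : X),
      responseLevel J ε (πbar₁.shift (x₀, a₁)) x ≤
        J (πbar₁.shift (x₀, a₁)) (π₂.shift (x₀, a₁, a₂)) x := by
  obtain hX | ⟨⟨x'⟩⟩ := isEmpty_or_nonempty X
  · refine ⟨⟨fun n => ⟨fun h => hX.elim h.2, fun h => hX.elim h.2, fun B hB => ?_⟩,
      fun n h => hX.elim h.2⟩, fun x₀ => hX.elim x₀⟩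
    have : IsEmpty (Hist X (A₁ × A₂) n) := ⟨fun h => hX.elim h.2⟩
    exact @measurable_of_empty _ _ (univSigma _) _ this _
  have : Nonempty A₁ := (M.adm₁_nonempty x').to_type
  have : Nonempty A₂ := (M.adm₂_nonempty x').to_type
  obtain ⟨φ, hφ, hJφ⟩ := hJ
  obtain ⟨πbar₂⟩ := nonempty_policy₂ M
  let S : (X × A₁) × X → ProbabilityMeasure (Path X A₁ A₂) := fun z =>
    inducedLawFrom M z.2 (πbar₁.shift z.1) πbar₂
  have hlaw : ∀ (x : X) (π₁ : Policy₁ M) (π₂ : Policy₂ M), IsInducedBy M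
      (Measure.dirac x) π₁ π₂ (inducedLawFrom M x π₁ π₂).toMeasure :=
    fun x π₁ π₂ => inducedLaw_spec M ⟨Measure.dirac x, inferInstance⟩ π₁ π₂
  have hS : @Measurable _ _ (univSigma ((X × A₁) × X)) _ S :=
    measurable_of_isInducedBy M measurable_snd (fun z => πbar₁.shift z.1) (fun _ => πbar₂)
      (fun n => (πbar₁.kernel (n + 1)).comap
        (fun y : ((X × A₁) × X) × Hist X A₁ n => Hist.cons y.1.1 y.2)
        (measurable_cons_prod.comp (measurable_fst.fst.prodMk measurable_snd)))
      (fun n z i => rfl) (fun n => (πbar₂.kernel n).comap Prod.snd measurable_snd)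
      (fun n z h => rfl) S (fun z => hlaw _ _ _)
  -- This is where the absolute continuity assumption enters.
  have hcons : ∀ z π₂, Consistent M (S z) (inducedLawFrom M z.2 (πbar₁.shift z.1) π₂) :=
    fun z π₂ => (hlaw _ _ _).consistent (hlaw _ _ _) fun n => (hAbs _ π₂ πbar₂ _ n).1
  have hreal : ∀ Ψ (hΨ : @Measurable _ _ (univSigma ((X × A₁) × X)) _ Ψ) (b : X × A₁ × A₂) (x : X),
      Consistent M (S ((b.1, b.2.1), x)) (Ψ ((b.1, b.2.1), x)) →
      inducedLawFrom M x (πbar₁.shift (b.1, b.2.1)) ((responsePolicy πbar₂ Ψ hΨ).shift b) =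
        Ψ ((b.1, b.2.1), x) := fun Ψ hΨ b x hc =>
    Subtype.ext ((hlaw _ _ _).unique
      (isInducedBy_responsePolicy πbar₂ Ψ hΨ b x (hlaw x (πbar₁.shift (b.1, b.2.1)) πbar₂) hc))
  have : Nonempty (ProbabilityMeasure (Path X A₁ A₂)) :=
    ⟨inducedLawFrom M x' πbar₁ πbar₂⟩
  -- The selection is over pairs of laws, where the constraint is analytic; `S` is substituted only
  -- afterwards.
  obtain ⟨ψ, hψ, hψD⟩ := exists_nearOptimal_section (isAnalytic_consistent M) hφ hε
  have hΨ : @Measurable _ _ (univSigma ((X × A₁) × X)) _ fun z => ψ (S z) :=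
    measurable_univSigma_comp hψ hS
  refine ⟨responsePolicy πbar₂ _ hΨ, fun x₀ a₁ a₂ x => ?_⟩
  obtain ⟨h1, h2⟩ := hψD (S ((x₀, a₁), x)) ⟨_, hcons _ πbar₂⟩
  rw [hJφ, hreal _ hΨ (x₀, a₁, a₂) x h1]
  refine le_trans (le_of_eq ?_) h2
  have hsup : (⨆ π₂ : Policy₂ M, J (πbar₁.shift (x₀, a₁)) π₂ x) =
      fibreSup {y | Consistent M y.1 y.2} φ (S ((x₀, a₁), x)) := by
    refine le_antisymm (iSup_le fun π₂ => ?_) (iSup₂_le fun ρ hρ => ?_)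
    · rw [hJφ]
      exact le_iSup₂_of_le _ (hcons ((x₀, a₁), x) π₂) le_rfl
    -- A single consistent law is attained by the response policy of the constant family.
    · refine le_iSup_of_le ((responsePolicy πbar₂ (fun _ => ρ)
        measurable_const.univSigma).shift (x₀, a₁, a₂)) (le_of_eq ?_)
      rw [hJφ, hreal (fun _ => ρ) measurable_const.univSigma (x₀, a₁, a₂) x hρ]
  simp only [responseLevel, nearLevel, hsup]

end Minimax

end

theorem mainTheorem11 {X : Type*} {A₁ : Type*} {A₂ : Type*}
    [MeasurableSpace X] [StandardBorelSpace X]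
    [MeasurableSpace A₁] [StandardBorelSpace A₁]
    [MeasurableSpace A₂] [StandardBorelSpace A₂]
    (M : Minimax.Model X A₁ A₂)
    (J : Minimax.Policy₁ M → Minimax.Policy₂ M → X → EReal)
    (hAbs : Minimax.AbsContAssumption M)
    (hJ : Minimax.CriterionAssumption M J)
    (πbar₁ : Minimax.Policy₁ M) (ε : ℝ) (hε : 0 < ε) :
    ∃ π₂ : Minimax.Policy₂ M, ∀ (x₀ : X) (a₁ : A₁) (a₂ : A₂) (x : X),
      Minimax.responseLevel J ε (πbar₁.shift (x₀, a₁)) x ≤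
        J (πbar₁.shift (x₀, a₁)) (π₂.shift (x₀, a₁, a₂)) x :=
  Minimax.exists_nearOptimal_response M J hAbs hJ πbar₁ ε hε
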